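/- \textbf{Setting.} Equip $\mathbb R^4$ with the Minkowski product $p\cdot x=p_0x_0-\boldsymbol p\boldsymbol x$. Let $V=\{x: x_0>|\boldsymbol x|\}$ be the open forward light cone and $\overline V=\{x: x_0\ge|\boldsymbol x|\}$ its closure. Let $\mathcal L_+^\uparrow$ be the group of proper orthochronous Lorentz transformations, $\mathcal P=\mathbb R^4\rtimes\mathcal L_+^\uparrow$ the Poincaré group with its usual topology, and $\mathcal S=\overline V\rtimes\mathcal L_+^\uparrow\subset\mathcal P$ the semigroup of those $\lambda=(x,\Lambda)$ whose translation part $x$ is future directed; $\mathcal S$ maps $V$ into itself. A double cone in $V$ is a set $\mathcal O=(a+V)\cap(b-V)$ with $a\in V$, $b-a\in V$. For $X\subset V$ let $X^c$ be the interior of $\{y\in V:(x-y)^2<0\text{ for all }x\in X\}$. Let $\mathcal O\mapsto\mathcal A(\mathcal O)$ be a net of unital $C^*$-algebras on the double cones in $V$, with $C^*$-inductive limit $\mathcal A(V)$: the $\mathcal A(\mathcal O)$ are closed $*$-subalgebras of the unital $C^*$-algebra $\mathcal A(V)$ containing its unit, $\mathcal A(\mathcal O_1)\subset\mathcal A(\mathcal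 O_2)$ if $\mathcal O_1\subset\mathcal O_2$, and $\bigcup_{\mathcal O}\mathcal A(\mathcal O)$ is dense. Assume locality, i.e. $[\mathcal A(\mathcal O_1),\mathcal A(\mathcal O_2)]=0$ if $\mathcal O_1\subset\mathcal O_2^{\,c}$, and that $\mathcal S$ acts on $\mathcal A(V)$ by unital $*$-endomorphisms $\alpha_\lambda$ (with $\alpha_{\lambda\mu}=\alpha_\lambda\alpha_\mu$, $\alpha_1=\mathrm{id}$) such that $\alpha_\lambda(\mathcal A(\mathcal O))=\mathcal A(\lambda\mathcal O)$. Write $\alpha_x=\alpha_{(x,1)}$. A state $\omega_0$ on $\mathcal A(V)$ is a \emph{vacuum state} if (a) $\omega_0\circ\alpha_\lambda=\omega_0$ for $\lambda\in\mathcal S$; (b) $\mathcal S\ni\lambda\mapsto\omega_0(A^*\alpha_\lambda(B))$ is continuous for all $A,B\in\mathcal A(V)$; (c) for all $A,B\in\mathcal A(V)$ the function $\overline V\ni x\mapsto\omega_0(A^*\alpha_x(B))$ extends to a continuous function on $\overline V+i\overline V\subset\mathbb C^4$ which is analytic in the interior and whose modulus is bounded by $\sqrt{\omega_0(A^*A)\,\omega_0(B^*B)}$.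 For a strongly continuous unitary representation $T$ of $\mathbb R^4$ on a Hilbert space, its spectrum (the joint spectrum of the generators $P$ in $T(x)=e^{iP\cdot x}$) is the set of all $p\in\mathbb R^4$ such that $\int f(x)e^{ip\cdot x}\,dx=0$ for every $f\in L^1(\mathbb R^4)$ with $\int f(x)T(x)\,dx=0$. \textbf{Proposition.} Let $\omega_0$ be a vacuum state on $\mathcal A(V)$ with GNS representation $(\pi_0,\mathcal H,\Omega)$. Then (i) $\Omega$ is cyclic for $\pi_0(\alpha_\lambda(\mathcal A(V)))$, i.e. $\pi_0(\alpha_\lambda(\mathcal A(V)))\Omega$ is dense in $\mathcal H$, for every $\lambda\in\mathcal S$; and there is a strongly continuous unitary representation $U_0$ of $\mathcal P$ on $\mathcal H$ such that (ii) $U_0(\lambda)\Omega=\Omega$ for all $\lambda\in\mathcal P$, and $U_0(\lambda)\,\pi_0(A)\,U_0(\lambda)^*=\pi_0(\alpha_\lambda(A))$ for all $\lambda\in\mathcal S$, $A\in\mathcal A(V)$; (iii) the spectrum of $U_0\restriction\mathbb R^4$ is contained in $\overline V$. -/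

import Mathlib

open scoped ComplexOrder

noncomputable section

open scoped Matrix InnerProductSpace

namespace LightCone

/-! ### Minkowski space and the forward light cone -/

/-- Coordinates `x = (x 0, x 1, x 2, x 3)` of Minkowski space, `x 0` being the time. -/
abbrev Spacetime := Fin 4 → ℝ

/-- The metric tensor with signature `(+,-,-,-)`. -/
def eta : Matrix (Fin 4) (Fin 4) ℝ := Matrix.diagonal ![1, -1, -1, -1]

/-- The Minkowski scalar product `x 0 * y 0 - x 1 * y 1 - x 2 * y 2 - x 3 * y 3`. -/
def mdot (x y : Spacetime) : ℝ := x ⬝ᵥ (eta *ᵥ y)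

/-- The open forward light cone `{x | x₀ > |𝐱|}` with apex `0`. -/
def forwardCone : Set Spacetime := {x | 0 < x 0 ∧ 0 < mdot x x}

/-- The closed forward light cone `{x | x₀ ≥ |𝐱|}`; as a set of translations these are the
future directed ones. -/
def closedForwardCone : Set Spacetime := {x | 0 ≤ x 0 ∧ 0 ≤ mdot x x}

/-- The spacelike complement, within the light cone, of a set of points. -/
def spacelikeComplement (X : Set Spacetime) : Set Spacetime :=
  interior {y | y ∈ forwardCone ∧ ∀ x ∈ X, mdot (x - y) (x - y) < 0}

/-- The open double cone with past tip `a` and future tip `b`. -/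
def doubleCone (a b : Spacetime) : Set Spacetime :=
  {x | x - a ∈ forwardCone ∧ b - x ∈ forwardCone}

/-- The (nonempty) double cones that are relatively compact in the forward light cone. -/
def doubleCones : Set (Set Spacetime) :=
  {O | ∃ a b, a ∈ forwardCone ∧ b - a ∈ forwardCone ∧ O = doubleCone a b}

lemma mdot_eq (x y : Spacetime) :
    mdot x y = x 0 * y 0 - x 1 * y 1 - x 2 * y 2 - x 3 * y 3 := by
  simp [mdot, eta, Matrix.mulVec_diagonal, dotProduct, Fin.sum_univ_four]
  ring

lemma time_part_nonneg {a x : Spacetime} (ha : 0 ≤ a 0) (ha' : 0 ≤ mdot a a)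
    (hx : 0 ≤ x 0) (hx' : 0 ≤ mdot x x) : 0 ≤ a ⬝ᵥ x := by
  rw [mdot_eq] at ha' hx'
  have hE : a ⬝ᵥ x = a 0 * x 0 + (a 1 * x 1 + a 2 * x 2 + a 3 * x 3) := by
    simp [dotProduct, Fin.sum_univ_four]; ring
  have h1 : (a 1 * x 1 + a 2 * x 2 + a 3 * x 3) ^ 2 ≤
      (a 1 ^ 2 + a 2 ^ 2 + a 3 ^ 2) * (x 1 ^ 2 + x 2 ^ 2 + x 3 ^ 2) := by
    nlinarith [sq_nonneg (a 1 * x 2 - a 2 * x 1), sq_nonneg (a 1 * x 3 - a 3 * x 1),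
      sq_nonneg (a 2 * x 3 - a 3 * x 2)]
  have h2 : (a 1 ^ 2 + a 2 ^ 2 + a 3 ^ 2) * (x 1 ^ 2 + x 2 ^ 2 + x 3 ^ 2) ≤
      a 0 ^ 2 * x 0 ^ 2 :=
    mul_le_mul (by nlinarith) (by nlinarith) (by positivity) (by positivity)
  have h3 : (a 1 * x 1 + a 2 * x 2 + a 3 * x 3) ^ 2 ≤ (a 0 * x 0) ^ 2 := by
    rw [mul_pow]; exact h1.trans h2
  rw [hE]
  linarith [neg_abs_le (a 1 * x 1 + a 2 * x 2 + a 3 * x 3),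
    abs_le_of_sq_le_sq h3 (mul_nonneg ha hx)]

lemma time_part_pos {a x : Spacetime} (ha : 0 < a 0) (ha' : 0 < mdot a a)
    (hx : 0 < x 0) (hx' : 0 ≤ mdot x x) : 0 < a ⬝ᵥ x := by
  rw [mdot_eq] at ha' hx'
  have hE : a ⬝ᵥ x = a 0 * x 0 + (a 1 * x 1 + a 2 * x 2 + a 3 * x 3) := by
    simp [dotProduct, Fin.sum_univ_four]; ring
  have h1 : (a 1 * x 1 + a 2 * x 2 + a 3 * x 3) ^ 2 ≤
      (a 1 ^ 2 + a 2 ^ 2 + a 3 ^ 2) * (x 1 ^ 2 + x 2 ^ 2 + x 3 ^ 2) := by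
    nlinarith [sq_nonneg (a 1 * x 2 - a 2 * x 1), sq_nonneg (a 1 * x 3 - a 3 * x 1),
      sq_nonneg (a 2 * x 3 - a 3 * x 2)]
  have h2 : (a 1 ^ 2 + a 2 ^ 2 + a 3 ^ 2) * (x 1 ^ 2 + x 2 ^ 2 + x 3 ^ 2) <
      a 0 ^ 2 * x 0 ^ 2 :=
    mul_lt_mul_of_lt_of_le_of_nonneg_of_pos (by nlinarith) (by nlinarith) (by positivity)
      (by positivity)
  have h3 : (a 1 * x 1 + a 2 * x 2 + a 3 * x 3) ^ 2 < (a 0 * x 0) ^ 2 := by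
    rw [mul_pow]; exact h1.trans_lt h2
  rw [hE]
  linarith [neg_abs_le (a 1 * x 1 + a 2 * x 2 + a 3 * x 3),
    abs_lt_of_sq_lt_sq h3 (mul_pos ha hx).le]

lemma mdot_add_self (x y : Spacetime) :
    mdot (x + y) (x + y) = mdot x x + mdot y y + 2 * mdot x y := by
  simp only [mdot_eq, Pi.add_apply]; ring

/-- Spatial reflection turns the Minkowski product into the Euclidean one. -/
lemma eta_mulVec_apply_zero (x : Spacetime) : (eta *ᵥ x) 0 = x 0 := by
  simp [eta, Matrix.mulVec_diagonal]

lemma mdot_eta_mulVec (x : Spacetime) : mdot (eta *ᵥ x) (eta *ᵥ x) = mdot x x := by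
  simp [mdot_eq, eta, Matrix.mulVec_diagonal]

lemma zero_mem_closedForwardCone : (0 : Spacetime) ∈ closedForwardCone := by
  simp [closedForwardCone, mdot_eq]

lemma forwardCone_subset_closed : forwardCone ⊆ closedForwardCone :=
  fun _ h => ⟨h.1.le, h.2.le⟩

lemma mdot_nonneg_of_mem {x y : Spacetime} (hx : x ∈ closedForwardCone)
    (hy : y ∈ closedForwardCone) : 0 ≤ mdot x y :=
  time_part_nonneg hx.1 hx.2 (by rw [eta_mulVec_apply_zero]; exact hy.1)
    (by rw [mdot_eta_mulVec]; exact hy.2)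

lemma add_mem_closedForwardCone {x y : Spacetime} (hx : x ∈ closedForwardCone)
    (hy : y ∈ closedForwardCone) : x + y ∈ closedForwardCone := by
  refine ⟨add_nonneg hx.1 hy.1, ?_⟩
  rw [mdot_add_self]
  linarith [hx.2, hy.2, mdot_nonneg_of_mem hx hy]

lemma add_mem_forwardCone {x y : Spacetime} (hx : x ∈ closedForwardCone)
    (hy : y ∈ forwardCone) : x + y ∈ forwardCone := by
  refine ⟨add_pos_of_nonneg_of_pos hx.1 hy.1, ?_⟩
  rw [mdot_add_self]
  linarith [hx.2, hy.2, mdot_nonneg_of_mem hx (forwardCone_subset_closed hy)]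

/-! ### Proper orthochronous Lorentz transformations -/

lemma eta_mul_eta : eta * eta = 1 := by
  rw [eta, Matrix.diagonal_mul_diagonal, ← Matrix.diagonal_one]
  congr 1
  ext i
  fin_cases i <;> simp

lemma mdot_mulVec {M : Matrix (Fin 4) (Fin 4) ℝ} (h : Mᵀ * eta * M = eta) (x y : Spacetime) :
    mdot (M *ᵥ x) (M *ᵥ y) = mdot x y := by
  calc mdot (M *ᵥ x) (M *ᵥ y) = x ⬝ᵥ ((Mᵀ * eta * M) *ᵥ y) := by
        rw [mdot, ← Matrix.vecMul_transpose, ← Matrix.dotProduct_mulVec, Matrix.mulVec_mulVec,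
          Matrix.mulVec_mulVec, mul_assoc]
    _ = mdot x y := by rw [h, mdot]

lemma mul_eta_mul_transpose {M : Matrix (Fin 4) (Fin 4) ℝ} (h : Mᵀ * eta * M = eta) :
    M * eta * Mᵀ = eta := by
  have h1 : (eta * Mᵀ * eta) * M = 1 := by
    rw [mul_assoc eta, mul_assoc eta, h, eta_mul_eta]
  have h2 := mul_eq_one_comm.mp h1
  calc M * eta * Mᵀ = (M * (eta * Mᵀ * eta)) * eta := by
        simp only [mul_assoc, eta_mul_eta, mul_one]
    _ = eta := by rw [h2, one_mul]

lemma mdot_row {M : Matrix (Fin 4) (Fin 4) ℝ} (h : Mᵀ * eta * M = eta) :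
    mdot (M 0) (M 0) = 1 := by
  have h1 := congrFun (congrFun (mul_eta_mul_transpose h) 0) 0
  simp [eta, Matrix.mul_apply, Matrix.diagonal, Fin.sum_univ_four] at h1
  rw [mdot_eq]
  linarith

lemma mulVec_mem_forwardCone {M : Matrix (Fin 4) (Fin 4) ℝ} (h : Mᵀ * eta * M = eta)
    (h0 : 0 < M 0 0) {x : Spacetime} (hx : x ∈ forwardCone) : M *ᵥ x ∈ forwardCone :=
  ⟨time_part_pos h0 (by rw [mdot_row h]; exact one_pos) hx.1 hx.2.le, by
    rw [mdot_mulVec h]; exact hx.2⟩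

lemma mulVec_mem_closedForwardCone {M : Matrix (Fin 4) (Fin 4) ℝ} (h : Mᵀ * eta * M = eta)
    (h0 : 0 < M 0 0) {x : Spacetime} (hx : x ∈ closedForwardCone) :
    M *ᵥ x ∈ closedForwardCone :=
  ⟨time_part_nonneg h0.le (by rw [mdot_row h]; exact zero_le_one) hx.1 hx.2, by
    rw [mdot_mulVec h]; exact hx.2⟩

/-- The group of proper orthochronous Lorentz transformations: `Λᵀ η Λ = η`, `det Λ = 1` and
`Λ₀₀ > 0`. Its topology is the one inherited from the matrices. -/
def Lorentz : Subgroup (Matrix.GeneralLinearGroup (Fin 4) ℝ) where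
  carrier := {L | (L.val)ᵀ * eta * L.val = eta ∧ L.val.det = 1 ∧ 0 < L.val 0 0}
  one_mem' := by simp
  mul_mem' := by
    rintro L K ⟨hL, dL, pL⟩ ⟨hK, dK, pK⟩
    refine ⟨?_, ?_, ?_⟩
    · calc ((L * K).val)ᵀ * eta * (L * K).val
          = (K.val)ᵀ * ((L.val)ᵀ * eta * L.val) * K.val := by
            simp [Matrix.transpose_mul, mul_assoc]
        _ = eta := by rw [hL, hK]
    · simp only [Units.val_mul, Matrix.det_mul, dL, dK, mul_one]
    · have hK' : (Matrix.col K.val 0) ∈ forwardCone := by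
        have e : K.val *ᵥ (Pi.single 0 1) = Matrix.col K.val 0 := by simp
        refine ⟨pK, ?_⟩
        rw [← e, mdot_mulVec hK, mdot_eq]
        simp
      exact (mulVec_mem_forwardCone hL pL hK').1
  inv_mem' := by
    rintro L ⟨hL, dL, pL⟩
    have h1 : (eta * (L.val)ᵀ * eta) * L.val = 1 := by
      rw [mul_assoc eta, mul_assoc eta, hL, eta_mul_eta]
    have h2 : (L⁻¹).val = eta * (L.val)ᵀ * eta := by
      calc (L⁻¹).val = ((eta * (L.val)ᵀ * eta) * L.val) * (L⁻¹).val := by rw [h1, one_mul]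
        _ = eta * (L.val)ᵀ * eta := by rw [mul_assoc, Units.mul_inv, mul_one]
    refine ⟨?_, ?_, ?_⟩
    · have e : etaᵀ = eta := by simp [eta]
      rw [h2]
      simp only [Matrix.transpose_mul, Matrix.transpose_transpose, e]
      calc eta * (L.val * eta) * eta * (eta * (L.val)ᵀ * eta)
          = eta * (L.val * eta * (eta * eta) * (L.val)ᵀ) * eta := by simp only [mul_assoc]
        _ = eta := by
            rw [eta_mul_eta, mul_one, mul_eta_mul_transpose hL, eta_mul_eta, one_mul]
    · have := congrArg Matrix.det (Units.mul_inv L)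
      rwa [Matrix.det_mul, dL, one_mul, Matrix.det_one] at this
    · show 0 < (L⁻¹).val 0 0
      rw [h2]
      simpa [eta, Matrix.mul_apply, Matrix.diagonal, Fin.sum_univ_four] using pL

/-- The Lorentz transformation applied to a point. -/
def lorentzApply (L : Lorentz) (x : Spacetime) : Spacetime := L.val.val *ᵥ x

lemma lorentzApply_add (L : Lorentz) (x y : Spacetime) :
    lorentzApply L (x + y) = lorentzApply L x + lorentzApply L y := Matrix.mulVec_add _ _ _

lemma lorentzApply_sub (L : Lorentz) (x y : Spacetime) :
    lorentzApply L (x - y) = lorentzApply L x - lorentzApply L y := Matrix.mulVec_sub _ _ _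

lemma lorentzApply_one (x : Spacetime) : lorentzApply 1 x = x := Matrix.one_mulVec x

lemma lorentzApply_mul (L K : Lorentz) (x : Spacetime) :
    lorentzApply (L * K) x = lorentzApply L (lorentzApply K x) :=
  (Matrix.mulVec_mulVec _ _ _).symm

lemma lorentzApply_mem_forwardCone (L : Lorentz) {x : Spacetime} (hx : x ∈ forwardCone) :
    lorentzApply L x ∈ forwardCone := mulVec_mem_forwardCone L.2.1 L.2.2.2 hx

lemma lorentzApply_mem_closedForwardCone (L : Lorentz) {x : Spacetime}
    (hx : x ∈ closedForwardCone) : lorentzApply L x ∈ closedForwardCone :=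
  mulVec_mem_closedForwardCone L.2.1 L.2.2.2 hx

/-- The action of the Lorentz group on the (multiplicatively written) translation group. -/
def lorentzAut : Lorentz →* MulAut (Multiplicative Spacetime) where
  toFun L := AddEquiv.toMultiplicative
    { toFun := lorentzApply L
      invFun := lorentzApply L⁻¹
      left_inv := fun x => by rw [← lorentzApply_mul, inv_mul_cancel, lorentzApply_one]
      right_inv := fun x => by rw [← lorentzApply_mul, mul_inv_cancel, lorentzApply_one]
      map_add' := lorentzApply_add L }
  map_one' := by
    ext x : 1
    exact congrArg Multiplicative.ofAdd (lorentzApply_one x.toAdd)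
  map_mul' L K := by
    ext x : 1
    exact congrArg Multiplicative.ofAdd (lorentzApply_mul L K x.toAdd)

/-! ### The Poincaré group and the semigroup acting on the light cone -/

/-- The Poincaré group, the semidirect product of the translations `ℝ⁴` with the proper
orthochronous Lorentz group; `(x, Λ) (y, K) = (x + Λ y, Λ K)`. -/
abbrev Poincare := Multiplicative Spacetime ⋊[lorentzAut] Lorentz

/-- The Poincaré group carries the topology of the product `ℝ⁴ × Lorentz`. -/
instance : TopologicalSpace Poincare :=
  TopologicalSpace.induced (fun g => (g.left.toAdd, g.right)) inferInstance

/-- The translation part of a Poincaré transformation. -/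
def Poincare.shift (g : Poincare) : Spacetime := g.left.toAdd

/-- The pure translation by `x`. -/
def Poincare.translation (x : Spacetime) : Poincare := ⟨Multiplicative.ofAdd x, 1⟩

/-- The action `(x, Λ) y = x + Λ y` on points. -/
def Poincare.act (g : Poincare) (y : Spacetime) : Spacetime := g.shift + lorentzApply g.right y

/-- The semigroup of Poincaré transformations whose translation part is future directed. -/
def Semi : Submonoid Poincare where
  carrier := {g | g.shift ∈ closedForwardCone}
  one_mem' := zero_mem_closedForwardCone
  mul_mem' := by
    intro g h hg hh
    exact add_mem_closedForwardCone hg (lorentzApply_mem_closedForwardCone g.right hh)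

/-- Future directed translations as elements of the semigroup. -/
def Semi.translation (x : Spacetime) (hx : x ∈ closedForwardCone) : Semi :=
  ⟨Poincare.translation x, hx⟩

lemma act_image_doubleCone (g : Poincare) (a b : Spacetime) :
    g.act '' doubleCone a b = doubleCone (g.act a) (g.act b) := by
  have key : ∀ x y, g.act x - g.act y = lorentzApply g.right (x - y) := fun x y => by
    rw [lorentzApply_sub]; simp [Poincare.act]
  have back : ∀ x y, g.act x - g.act y ∈ forwardCone → x - y ∈ forwardCone := fun x y h => by
    rw [key] at h
    have := lorentzApply_mem_forwardCone g.right⁻¹ h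
    rwa [← lorentzApply_mul, inv_mul_cancel, lorentzApply_one] at this
  ext y
  constructor
  · rintro ⟨x, ⟨h1, h2⟩, rfl⟩
    exact ⟨by rw [key]; exact lorentzApply_mem_forwardCone _ h1,
      by rw [key]; exact lorentzApply_mem_forwardCone _ h2⟩
  · rintro ⟨h1, h2⟩
    have hy : g.act (lorentzApply g.right⁻¹ (y - g.shift)) = y := by
      rw [Poincare.act, ← lorentzApply_mul, mul_inv_cancel, lorentzApply_one]; abel
    rw [← hy] at h1 h2
    exact ⟨_, ⟨back _ _ h1, back _ _ h2⟩, hy⟩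

lemma act_image_mem_doubleCones (g : Semi) {O : Set Spacetime} (hO : O ∈ doubleCones) :
    g.val.act '' O ∈ doubleCones := by
  obtain ⟨a, b, ha, hab, rfl⟩ := hO
  refine ⟨g.val.act a, g.val.act b,
    add_mem_forwardCone g.2 (lorentzApply_mem_forwardCone _ ha), ?_, act_image_doubleCone _ _ _⟩
  have : g.val.act b - g.val.act a = lorentzApply g.val.right (b - a) := by
    rw [lorentzApply_sub]; simp [Poincare.act]
  rw [this]
  exact lorentzApply_mem_forwardCone _ hab

/-- The image of a double cone under an element of the semigroup. -/
def moveCone (g : Semi) (O : doubleCones) : doubleCones :=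
  ⟨g.val.act '' O.val, act_image_mem_doubleCones g O.2⟩

/-! ### Local nets on the light cone -/

/-- A local, covariant net of unital C*-algebras on the double cones of the light cone. The
ambient C*-algebra `A` is the algebra of the light cone, that is, the C*-inductive limit of the
local algebras. -/
structure LocalNet (A : Type*) [CStarAlgebra A] where
  /-- the local algebras -/
  alg : doubleCones → StarSubalgebra ℂ A
  isClosed_alg : ∀ O, IsClosed (alg O : Set A)
  isotony : ∀ O₁ O₂ : doubleCones, O₁.val ⊆ O₂.val → alg O₁ ≤ alg O₂
  dense_alg : Dense (⋃ O, (alg O : Set A))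
  locality : ∀ O₁ O₂ : doubleCones, O₁.val ⊆ spacelikeComplement O₂.val →
    ∀ a ∈ alg O₁, ∀ b ∈ alg O₂, a * b = b * a
  /-- the action of the semigroup by endomorphisms -/
  endo : Semi →* (A →⋆ₐ[ℂ] A)
  covariance : ∀ (g : Semi) (O : doubleCones), (alg O).map (endo g) = alg (moveCone g O)

/-! ### Vacuum states and their GNS representation -/

/-- The domain `V̄ + i V̄` in `ℂ⁴`, where `V̄` is the closed forward cone. -/
def complexCone : Set (Fin 4 → ℂ) :=
  {z | (fun i => (z i).re) ∈ closedForwardCone ∧ (fun i => (z i).im) ∈ closedForwardCone}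

section

variable {A : Type*} [CStarAlgebra A] [PartialOrder A] [StarOrderedRing A]

/-- Vacuum states on the algebra of the light cone. -/
structure IsVacuumState (N : LocalNet A) (ω : A →ₚ[ℂ] ℂ) : Prop where
  normalized : ω 1 = 1
  invariant : ∀ (g : Semi) (a : A), ω (N.endo g a) = ω a
  continuous : ∀ a b : A, Continuous fun g : Semi => ω (star a * N.endo g b)
  analytic : ∀ a b : A, ∃ F : (Fin 4 → ℂ) → ℂ,
    ContinuousOn F complexCone ∧
    AnalyticOnNhd ℂ F (interior complexCone) ∧
    (∀ z ∈ complexCone, ‖F z‖ ≤ √((ω (star a * a)).re * (ω (star b * b)).re)) ∧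
    ∀ (x : Spacetime) (hx : x ∈ closedForwardCone),
      F (fun i => (x i : ℂ)) = ω (star a * N.endo (Semi.translation x hx) b)

/-- The GNS vector, the class of the unit. -/
def gnsVector (ω : A →ₚ[ℂ] ℂ) : ω.GNS := (ω.toPreGNS 1 : ω.PreGNS)

end

section

variable {H : Type*} [NormedAddCommGroup H] [InnerProductSpace ℂ H] [CompleteSpace H]

/-- A vector `Ω` is cyclic for a *-algebra of bounded operators `B` if `B Ω` is dense. -/
def IsCyclic (B : StarSubalgebra ℂ (H →L[ℂ] H)) (Ω : H) : Prop :=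
  Dense {ψ | ∃ T ∈ B, T Ω = ψ}

/-- The spectrum of a (strongly continuous) unitary representation `T` of the translation group
`ℝ⁴`, i.e. the joint spectrum of its generators, with the sign convention
`T x = exp (i P · x)` for the Minkowski product `p · x`: a momentum `p` belongs to it iff
`∫ f(x) exp(i p · x) dx = 0` for all integrable `f` with `∫ f(x) T(x) dx = 0` (weak integral). -/
def translationSpectrum (T : Spacetime → H →L[ℂ] H) : Set Spacetime :=
  {p | ∀ f : Spacetime → ℂ, MeasureTheory.Integrable f →
    (∀ φ ψ : H, ∫ x, f x * ⟪φ, T x ψ⟫_ℂ = 0) →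
    ∫ x, f x * Complex.exp (Complex.I * (mdot p x : ℂ)) = 0}

end

end LightCone

end

open scoped ComplexOrder InnerProductSpace

namespace LightCone

open Complex Set Filter Topology MeasureTheory UniformSpace

/-! ### Bounded analytic functions on a quadrant -/

/-! Invariance of the state makes `gnsClass ω a ↦ gnsClass ω (N.endo g a)` isometric, which gives a
representation V of the semigroup by isometries (`vacuumRep`). The heart of the matter is that every
V(g) is onto.

Along a timelike direction e, property (c) of the vacuum extends t ↦ ⟨φ, V(te)ψ⟩ to a bounded
continuous function on the closed first quadrant, analytic inside. If ψ is orthogonal to the range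
of V(e), then ⟨ψ, V(te)ψ⟩ vanishes for t ≥ 1, because V(te) = V(e)V((t-1)e). A bounded analytic
function on the quadrant that vanishes on a boundary half-line is zero
(`eqOn_zero_of_eq_zero_on_halfLine`, by three lines), so t = 0 gives ‖ψ‖² = 0. A general g is a left
factor of some timelike translation, so V(g) has dense range too and is unitary
(`mem_unitary_of_hasQuadrantExtension`). Cyclicity follows, since V(g) carries a dense set to a
dense set. As s and s * g lie in the semigroup for a suitable s, U(g) = V(s)⁻¹V(sg) extends V to the
group (`exists_monoidHom_extend`).

For the spectrum, take p outside the closed cone and a timelike e with b = -p·e > 0. Now u(t) = ⟨φ,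
U(y + te)ψ⟩ has an extension with the same bound on each quadrant with corner at -r. Cauchy's
theorem on growing rectangles gives ∫ h u = 0 for the kernel h = `halfPlaneFn b`, which is analytic
in the upper half plane and decays quadratically (`integral_halfPlaneFn_mul_eq_zero`). Smearing h
along e produces an integrable f with ∫ f U = 0, while ∫ f(x) exp(i p·x) dx contains the nonzero
factor ∫ h(t) exp(-ibt) dt. Hence p is not in the spectrum. -/

/-- The open first quadrant of the complex plane. -/
def openQuadrant : Set ℂ := {z | 0 < z.re ∧ 0 < z.im}

/-- The closed first quadrant of the complex plane. -/
def closedQuadrant : Set ℂ := {z | 0 ≤ z.re ∧ 0 ≤ z.im}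

lemma isOpen_openQuadrant : IsOpen openQuadrant :=
  (isOpen_lt continuous_const continuous_re).inter (isOpen_lt continuous_const continuous_im)

lemma convex_openQuadrant : Convex ℝ openQuadrant :=
  (convex_halfSpace_re_gt 0).inter (convex_halfSpace_im_gt 0)

lemma openQuadrant_subset_closedQuadrant : openQuadrant ⊆ closedQuadrant :=
  fun _ h => ⟨h.1.le, h.2.le⟩

lemma closedQuadrant_subset_closure : closedQuadrant ⊆ closure openQuadrant := by
  intro z hz
  have hlim : Tendsto (fun t : ℝ => z + t * (1 + I)) (𝓝[>] 0) (𝓝 z) := by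
    have : Continuous fun t : ℝ => z + t * (1 + I) := by fun_prop
    have h := this.tendsto 0
    simp only [ofReal_zero, zero_mul, add_zero] at h
    exact h.mono_left nhdsWithin_le_nhds
  refine mem_closure_of_tendsto hlim ?_
  filter_upwards [self_mem_nhdsWithin] with t ht
  have ht' : (0 : ℝ) < t := ht
  exact ⟨by simpa using add_pos_of_nonneg_of_pos hz.1 ht',
    by simpa using add_pos_of_nonneg_of_pos hz.2 ht'⟩

lemma ofReal_mem_closedQuadrant {t : ℝ} (ht : 0 ≤ t) : (t : ℂ) ∈ closedQuadrant :=
  ⟨by simpa using ht, by simp⟩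

/-- Logarithmic coordinates: exp(iπw/2) has argument π Re w / 2, so the strip 0 ≤ Re w ≤ 1 becomes a
quadrant and its edge Re w = 0 becomes the real half-line beyond c. This makes the three lines
theorem applicable. -/
lemma ofReal_add_exp_mem_closedQuadrant {c : ℝ} (hc : 0 ≤ c) {w : ℂ}
    (hw : 0 ≤ w.re ∧ w.re ≤ 1) : (c : ℂ) + exp (I * (Real.pi / 2) * w) ∈ closedQuadrant := by
  have him : (I * (Real.pi / 2) * w).im = Real.pi / 2 * w.re := by
    have : (I * (Real.pi / 2) * w) = ((Real.pi / 2 : ℝ) : ℂ) * (I * w) := by push_cast; ring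
    rw [this, im_ofReal_mul]; simp
  have h0 : 0 ≤ Real.pi / 2 * w.re := mul_nonneg (by positivity) hw.1
  have h1 : Real.pi / 2 * w.re ≤ Real.pi / 2 := mul_le_of_le_one_right (by positivity) hw.2
  have hpi := Real.pi_pos
  refine ⟨?_, ?_⟩
  · rw [add_re, exp_re, him, ofReal_re]
    exact add_nonneg hc (mul_nonneg (Real.exp_pos _).le
      (Real.cos_nonneg_of_mem_Icc ⟨by linarith, h1⟩))
  · rw [add_im, exp_im, him, ofReal_im, zero_add]
    exact mul_nonneg (Real.exp_pos _).le (Real.sin_nonneg_of_nonneg_of_le_pi h0 (by linarith))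

lemma ofReal_add_exp_mem_openQuadrant {c : ℝ} (hc : 0 ≤ c) {w : ℂ}
    (hw : 0 < w.re ∧ w.re < 1) : (c : ℂ) + exp (I * (Real.pi / 2) * w) ∈ openQuadrant := by
  have him : (I * (Real.pi / 2) * w).im = Real.pi / 2 * w.re := by
    have : (I * (Real.pi / 2) * w) = ((Real.pi / 2 : ℝ) : ℂ) * (I * w) := by push_cast; ring
    rw [this, im_ofReal_mul]; simp
  have h0 : 0 < Real.pi / 2 * w.re := mul_pos (by positivity) hw.1
  have h1 : Real.pi / 2 * w.re < Real.pi / 2 := mul_lt_of_lt_one_right (by positivity) hw.2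
  have hpi := Real.pi_pos
  refine ⟨?_, ?_⟩
  · rw [add_re, exp_re, him, ofReal_re]
    exact add_pos_of_nonneg_of_pos hc (mul_pos (Real.exp_pos _)
      (Real.cos_pos_of_mem_Ioo ⟨by linarith, h1⟩))
  · rw [add_im, exp_im, him, ofReal_im, zero_add]
    exact mul_pos (Real.exp_pos _) (Real.sin_pos_of_pos_of_lt_pi h0 (by linarith))

/-- A bounded function on the first quadrant which vanishes on a half-line of the boundary
vanishes identically. -/
lemma eqOn_zero_of_eq_zero_on_halfLine {f : ℂ → ℂ} (hf : ContinuousOn f closedQuadrant)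
    (hd : DifferentiableOn ℂ f openQuadrant) {C : ℝ} (hC : ∀ z ∈ closedQuadrant, ‖f z‖ ≤ C)
    {c : ℝ} (hc : 0 ≤ c) (h0 : ∀ t : ℝ, c ≤ t → f t = 0) : EqOn f 0 closedQuadrant := by
  set φ : ℂ → ℂ := fun w => (c : ℂ) + exp (I * (Real.pi / 2) * w) with hφ
  have hφd : Differentiable ℂ φ := by fun_prop
  -- Three lines with bounds 0 and C on the edges gives |f(φ w)| ≤ 0^(1 - Re w) · C^(Re w); the
  -- strict inequality keeps the exponent of 0 nonzero.
  have hstrip : ∀ w : ℂ, 0 ≤ w.re → w.re < 1 → f (φ w) = 0 := by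
    intro w hw0 hw1
    have hcl : closure (HadamardThreeLines.verticalStrip 0 1) ⊆
        HadamardThreeLines.verticalClosedStrip 0 1 :=
      closure_minimal (preimage_mono Ioo_subset_Icc_self) (isClosed_Icc.preimage continuous_re)
    have := HadamardThreeLines.norm_le_interp_of_mem_verticalClosedStrip₀₁' (f ∘ φ) (z := w)
      (a := 0) (b := C) ⟨hw0, hw1.le⟩
      ⟨hd.comp hφd.differentiableOn fun w hw => ofReal_add_exp_mem_openQuadrant hc hw,
        hf.comp hφd.continuous.continuousOn fun w hw =>
          ofReal_add_exp_mem_closedQuadrant hc (hcl hw)⟩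
      ⟨C, by
        rintro _ ⟨w, hw, rfl⟩
        exact hC _ (ofReal_add_exp_mem_closedQuadrant hc hw)⟩
      (fun w hw => by
        have hw' : w.re = 0 := hw
        have e : φ w = ((c + Real.exp (-(Real.pi / 2 * w.im)) : ℝ) : ℂ) := by
          have : I * (Real.pi / 2) * w = ((-(Real.pi / 2 * w.im) : ℝ) : ℂ) := by
            apply Complex.ext <;> simp [hw']
          simp only [hφ]
          rw [this]; push_cast; ring
        rw [Function.comp_apply, e, h0 _ (by linarith [Real.exp_pos (-(Real.pi / 2 * w.im))]),
          norm_zero])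
      (fun w hw => hC _ (ofReal_add_exp_mem_closedQuadrant hc
        (by have hw' : w.re = 1 := hw
            exact ⟨by rw [hw']; norm_num, hw'.le⟩)))
    rw [Real.zero_rpow (by linarith), zero_mul] at this
    simpa using this
  -- For c > 0 the image of φ misses part of the quadrant. Since φ is open at 1/2, f vanishes near
  -- φ(1/2), and the identity theorem does the rest.
  have hopen : EqOn f 0 openQuadrant := by
    have hw0 : (0 : ℝ) < (1 / 2 : ℂ).re ∧ (1 / 2 : ℂ).re < 1 := by norm_num
    refine (hd.analyticOnNhd isOpen_openQuadrant).eqOn_zero_of_preconnected_of_eventuallyEq_zero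
      convex_openQuadrant.isPreconnected (ofReal_add_exp_mem_openQuadrant hc hw0) ?_
    have hopenmap : 𝓝 (φ (1 / 2)) ≤ map φ (𝓝 (1 / 2)) := by
      have hderiv : HasStrictDerivAt φ (exp (I * (Real.pi / 2) * (1 / 2)) *
          (I * (Real.pi / 2))) (1 / 2) := by
        have h1 : HasStrictDerivAt (fun w : ℂ => I * (Real.pi / 2) * w) (I * (Real.pi / 2))
            (1 / 2) := by
          simpa using (hasStrictDerivAt_id (1 / 2 : ℂ)).const_mul (I * (Real.pi / 2))
        exact h1.cexp.const_add _
      rw [hderiv.map_nhds_eq (by simp [Real.pi_ne_zero, exp_ne_zero])]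
    refine hopenmap ?_
    rw [mem_map]
    have : HadamardThreeLines.verticalStrip 0 1 ∈ 𝓝 (1 / 2 : ℂ) :=
      (isOpen_Ioo.preimage continuous_re).mem_nhds hw0
    filter_upwards [this] with w hw
    exact hstrip w hw.1.le hw.2
  exact hopen.of_subset_closure hf continuousOn_const openQuadrant_subset_closedQuadrant
    closedQuadrant_subset_closure

/-- `u : ℝ → ℂ` restricts on the positive half-line to the boundary value of an analytic function
on the first quadrant which is continuous up to the boundary and bounded by `C`. -/
def HasQuadrantExtension (u : ℝ → ℂ) (C : ℝ) : Prop :=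
  ∃ f : ℂ → ℂ, ContinuousOn f closedQuadrant ∧ DifferentiableOn ℂ f openQuadrant ∧
    (∀ z ∈ closedQuadrant, ‖f z‖ ≤ C) ∧ ∀ t : ℝ, 0 ≤ t → f t = u t

lemma HasQuadrantExtension.eq_zero {u : ℝ → ℂ} {C : ℝ} (h : HasQuadrantExtension u C) {c : ℝ}
    (hc : 0 ≤ c) (h0 : ∀ t : ℝ, c ≤ t → u t = 0) {t : ℝ} (ht : 0 ≤ t) : u t = 0 := by
  obtain ⟨f, hf, hd, hC, hu⟩ := h
  rw [← hu t ht]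
  exact eqOn_zero_of_eq_zero_on_halfLine hf hd hC hc
    (fun s hs => by rw [hu s (hc.trans hs), h0 s hs]) (ofReal_mem_closedQuadrant ht)

/-- Analytic extensions of a bounded family of functions, depending additively on a vector, exist
for all vectors as soon as they exist for a dense set of vectors. -/
lemma hasQuadrantExtension_of_dense {H : Type*} [SeminormedAddCommGroup H] {L : ℝ → H →+ ℂ} {C : ℝ}
    (hL : ∀ t, 0 ≤ t → ∀ a, ‖L t a‖ ≤ C * ‖a‖) {D : AddSubgroup H} (hD : Dense (D : Set H))
    (hDL : ∀ a ∈ D, HasQuadrantExtension (fun t => L t a) (C * ‖a‖)) (a : H) :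
    HasQuadrantExtension (fun t => L t a) (C * ‖a‖) := by
  have hCabs : ∀ x : H, C * ‖x‖ ≤ |C| * ‖x‖ := fun x =>
    mul_le_mul_of_nonneg_right (le_abs_self C) (norm_nonneg _)
  obtain ⟨x, hxD, hx⟩ := mem_closure_iff_seq_limit.mp (hD a)
  choose f hf hd hb hv using fun n => hDL (x n) (hxD n)
  -- Extensions are unique, so `f m - f n` is the extension belonging to `x m - x n` and inherits
  -- its bound. Thus the extensions are uniformly Cauchy.
  have hdiff : ∀ m n, ∀ z ∈ closedQuadrant, ‖f m z - f n z‖ ≤ C * ‖x m - x n‖ := by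
    intro m n z hz
    obtain ⟨g, hg, hgd, hgb, hgv⟩ := hDL _ (D.sub_mem (hxD m) (hxD n))
    have h := eqOn_zero_of_eq_zero_on_halfLine (f := fun z => f m z - f n z - g z)
      (((hf m).sub (hf n)).sub hg) (((hd m).sub (hd n)).sub hgd)
      (C := C * ‖x m‖ + C * ‖x n‖ + C * ‖x m - x n‖)
      (fun z hz => (norm_sub_le _ _).trans (add_le_add ((norm_sub_le _ _).trans
        (add_le_add (hb m z hz) (hb n z hz))) (hgb z hz))) le_rfl
      (fun t ht => by simp [hv m t ht, hv n t ht, hgv t ht]) hz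
    rw [sub_eq_zero.mp (show f m z - f n z - g z = 0 from h)]
    exact hgb z hz
  have hxc : CauchySeq x := hx.cauchySeq
  have hunif : UniformCauchySeqOn f atTop closedQuadrant := by
    rw [Metric.uniformCauchySeqOn_iff]
    intro ε hε
    obtain ⟨n₀, hn₀⟩ := Metric.cauchySeq_iff.mp hxc (ε / (|C| + 1)) (by positivity)
    refine ⟨n₀, fun m hm n hn z hz => ?_⟩
    have h1 := hn₀ m hm n hn
    rw [dist_eq_norm] at h1 ⊢
    calc ‖f m z - f n z‖ ≤ |C| * ‖x m - x n‖ := (hdiff m n z hz).trans (hCabs _)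
      _ ≤ (|C| + 1) * ‖x m - x n‖ := by gcongr; linarith
      _ < (|C| + 1) * (ε / (|C| + 1)) := by gcongr
      _ = ε := by field_simp
  have hlim : ∀ z ∈ closedQuadrant, ∃ w, Tendsto (fun n => f n z) atTop (𝓝 w) := fun z hz =>
    cauchySeq_tendsto_of_complete (hunif.cauchySeq hz)
  classical
  choose! F hF using hlim
  have hFu : TendstoUniformlyOn f F atTop closedQuadrant :=
    hunif.tendstoUniformlyOn_of_tendsto hF
  refine ⟨F, hFu.continuousOn (Eventually.of_forall hf).frequently,
    (hFu.mono openQuadrant_subset_closedQuadrant).tendstoLocallyUniformlyOn.differentiableOn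
      (Eventually.of_forall hd) isOpen_openQuadrant, fun z hz => ?_, fun t ht => ?_⟩
  · exact le_of_tendsto_of_tendsto (hF z hz).norm (hx.norm.const_mul C)
      (Eventually.of_forall fun n => hb n z hz)
  · have h1 := hF t (ofReal_mem_closedQuadrant ht)
    have h2 : Tendsto (fun n => f n t) atTop (𝓝 (L t a)) := by
      simp only [fun n => hv n t ht]
      rw [tendsto_iff_norm_sub_tendsto_zero]
      have h3 := (tendsto_iff_norm_sub_tendsto_zero.mp hx).const_mul C
      rw [mul_zero] at h3
      refine squeeze_zero (fun _ => norm_nonneg _) (fun n => ?_) h3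
      rw [← map_sub]
      exact hL t ht _
    exact tendsto_nhds_unique h1 h2

/-! ### A test kernel on the upper half plane and the contour argument -/

/-- A function which is analytic and decays in the upper half plane; on the real line it equals
`(exp (i b t) - exp (-b)) / (t ^ 2 + 1)`. -/
noncomputable def halfPlaneFn (b : ℝ) (z : ℂ) : ℂ := dslope (fun w : ℂ => exp (I * b * w)) I z / (z + I)

lemma add_I_ne_zero {z : ℂ} (hz : 0 ≤ z.im) : z + I ≠ 0 := fun h => by
  have := congrArg Complex.im h
  simp at this
  linarith

lemma halfPlaneFn_differentiableAt (b : ℝ) {z : ℂ} (hz : 0 ≤ z.im) :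
    DifferentiableAt ℂ (halfPlaneFn b) z := by
  have h1 : Differentiable ℂ (dslope (fun w : ℂ => exp (I * b * w)) I) := by
    rw [← differentiableOn_univ, differentiableOn_dslope univ_mem]
    exact (by fun_prop : Differentiable ℂ fun w : ℂ => exp (I * b * w)).differentiableOn
  exact (h1 z).div (by fun_prop) (add_I_ne_zero hz)

lemma halfPlaneFn_eq (b : ℝ) {z : ℂ} (hz : z ≠ I) :
    halfPlaneFn b z = (exp (I * b * z) - exp (-b)) / (z ^ 2 + 1) := by
  have e : z ^ 2 + 1 = (z - I) * (z + I) := by linear_combination I_sq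
  have e2 : I * (b : ℂ) * I = -b := by linear_combination (b : ℂ) * I_sq
  rw [halfPlaneFn, dslope_of_ne _ hz, slope_def_field, e2, e, div_div]

/-- |exp(ibz)| = exp(-b Im z) ≤ 1, which is where the sign of b enters. At `I` the right side is 2/0
= 0, so that point is excluded. -/
lemma norm_halfPlaneFn_le {b : ℝ} (hb : 0 ≤ b) {z : ℂ} (hz : 0 ≤ z.im) (hz' : z ≠ I) :
    ‖halfPlaneFn b z‖ ≤ 2 / ‖z ^ 2 + 1‖ := by
  rw [halfPlaneFn_eq b hz', norm_div]
  gcongr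
  have h1 : ‖exp (I * b * z)‖ ≤ 1 := by
    rw [norm_exp, Real.exp_le_one_iff]
    simp
    positivity
  have h2 : ‖exp (-b : ℂ)‖ ≤ 1 := by
    rw [norm_exp, Real.exp_le_one_iff]
    simpa using hb
  linarith [norm_sub_le (exp (I * b * z)) (exp (-b))]

lemma norm_halfPlaneFn_ofReal_le {b : ℝ} (hb : 0 ≤ b) (t : ℝ) :
    ‖halfPlaneFn b t‖ ≤ 2 * (1 + t ^ 2)⁻¹ := by
  have h := norm_halfPlaneFn_le hb (z := t) (by simp) (fun h => by
    simpa using congrArg Complex.im h)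
  have e : ((t : ℂ) ^ 2 + 1) = ((1 + t ^ 2 : ℝ) : ℂ) := by push_cast; ring
  rwa [e, norm_real, Real.norm_of_nonneg (by positivity), div_eq_mul_inv] at h

lemma norm_halfPlaneFn_le_of_le {b : ℝ} (hb : 0 ≤ b) {z : ℂ} (hz : 0 ≤ z.im) {r : ℝ} (hr : 1 < r)
    (h : r ≤ ‖z‖) : ‖halfPlaneFn b z‖ ≤ 2 / (r ^ 2 - 1) := by
  refine (norm_halfPlaneFn_le hb hz ?_).trans ?_
  · rintro rfl
    rw [norm_I] at h; linarith
  · have h1 : ‖z‖ ^ 2 - 1 ≤ ‖z ^ 2 + 1‖ := by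
      have := norm_sub_le (z ^ 2 + 1) 1
      rw [add_sub_cancel_right, norm_pow, norm_one] at this
      linarith
    have h2 : r ^ 2 ≤ ‖z‖ ^ 2 := by gcongr
    have h3 : 0 < r ^ 2 - 1 := by nlinarith
    gcongr
    linarith

lemma continuous_halfPlaneFn_ofReal (b : ℝ) : Continuous fun t : ℝ => halfPlaneFn b t :=
  continuous_iff_continuousAt.mpr fun t =>
    (halfPlaneFn_differentiableAt b (by simp)).continuousAt.comp (f := fun t : ℝ => (t : ℂ))
      continuous_ofReal.continuousAt

lemma integrable_halfPlaneFn {b : ℝ} (hb : 0 ≤ b) : Integrable fun t : ℝ => halfPlaneFn b t :=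
  (integrable_inv_one_add_sq.const_mul 2).mono'
    (continuous_halfPlaneFn_ofReal b).aestronglyMeasurable
    (Eventually.of_forall (norm_halfPlaneFn_ofReal_le hb))

/-- The Fourier transform of `halfPlaneFn b` does not vanish at `-b`. -/
lemma integral_halfPlaneFn_mul_exp_ne_zero {b : ℝ} (hb : 0 < b) :
    ∫ t : ℝ, halfPlaneFn b t * exp (I * (-b * t : ℝ)) ≠ 0 := by
  have hint : Integrable fun t : ℝ => halfPlaneFn b t * exp (I * (-b * t : ℝ)) := by
    refine (integrable_halfPlaneFn hb.le).mul_bdd (c := 1) (by fun_prop)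
      (Eventually.of_forall fun t => ?_)
    rw [mul_comm, norm_exp_ofReal_mul_I]
  -- The integrand equals (1 - exp(-b) exp(-ibt)) / (1 + t²), whose real part is bounded below by a
  -- positive integrable function.
  have hpt : ∀ t : ℝ, (1 - Real.exp (-b)) * (1 + t ^ 2)⁻¹ ≤
      (halfPlaneFn b t * exp (I * (-b * t : ℝ))).re := by
    intro t
    have e : halfPlaneFn b t * exp (I * (-b * t : ℝ)) =
        ((1 + t ^ 2)⁻¹ : ℝ) * (1 - (Real.exp (-b) : ℝ) * exp ((-b * t : ℝ) * I)) := by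
      rw [halfPlaneFn_eq b (fun h => by simpa using congrArg Complex.im h)]
      have : exp (I * b * t) * exp (I * (-b * t : ℝ)) = 1 := by
        rw [← exp_add, exp_eq_one_iff]
        exact ⟨0, by push_cast; ring⟩
      rw [div_mul_eq_mul_div, sub_mul, this]
      push_cast
      rw [mul_comm I, add_comm 1 ((t : ℂ) ^ 2), div_eq_mul_inv, mul_comm]
    rw [e, re_ofReal_mul, mul_comm]
    gcongr
    rw [sub_re, one_re, re_ofReal_mul, exp_ofReal_mul_I_re]
    have := mul_le_of_le_one_right (Real.exp_pos (-b)).le (Real.cos_le_one (-b * t))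
    linarith
  have hpos : 0 < (∫ t : ℝ, halfPlaneFn b t * exp (I * (-b * t : ℝ))).re := by
    have h1 : (∫ t : ℝ, halfPlaneFn b t * exp (I * (-b * t : ℝ))).re =
        ∫ t : ℝ, (halfPlaneFn b t * exp (I * (-b * t : ℝ))).re := (integral_re hint).symm
    have h2 := integral_mono (integrable_inv_one_add_sq.const_mul (1 - Real.exp (-b)))
      hint.re hpt
    rw [integral_const_mul, integral_univ_inv_one_add_sq] at h2
    rw [h1]
    refine lt_of_lt_of_le ?_ h2
    have : Real.exp (-b) < 1 := by rw [Real.exp_lt_one_iff]; linarith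
    have := Real.pi_pos
    apply mul_pos <;> linarith
  intro h
  rw [h] at hpos
  simp at hpos

/-- Cauchy's theorem on a rectangle for functions with analytic extension. -/
lemma norm_integral_halfPlaneFn_mul_le {b : ℝ} (hb : 0 ≤ b) {u : ℝ → ℂ} {M : ℝ} {r : ℝ}
    (hr : 1 < r) (hu : HasQuadrantExtension (fun t => u (t - r)) M) :
    ‖∫ t in -r..r, halfPlaneFn b t * u t‖ ≤ 8 * M * (r / (r ^ 2 - 1)) := by
  obtain ⟨f, hf, hd, hM, hfu⟩ := hu
  have hr0 : 0 < r := by linarith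
  have hr2 : 0 < r ^ 2 - 1 := by nlinarith
  -- Coordinates are shifted by r, so the rectangle [-r, r] × [0, r] becomes [0, 2r] × [0, r]. Its
  -- three sides off the real axis have total length 4r and satisfy |z - r| ≥ r, whence |G| ≤ 2M /
  -- (r² - 1) there.
  set G : ℂ → ℂ := fun z => halfPlaneFn b (z - r) * f z with hG
  have hshift : ∀ {z : ℂ}, 0 ≤ z.im → DifferentiableAt ℂ (fun z => halfPlaneFn b (z - r)) z :=
    fun {z} hz => (halfPlaneFn_differentiableAt b (z := z - r) (by simpa using hz)).comp z
      (differentiableAt_id.sub_const _)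
  have hGc : ContinuousOn G closedQuadrant := ContinuousOn.mul
    (fun z hz => (hshift hz.2).continuousAt.continuousWithinAt) hf
  have hGd : DifferentiableOn ℂ G openQuadrant := DifferentiableOn.mul
    (fun z hz => (hshift hz.2.le).differentiableWithinAt) hd
  have key := integral_boundary_rect_eq_zero_of_continuousOn_of_differentiableOn G 0
    ((2 * r : ℝ) + (r : ℝ) * I) (hGc.mono (fun z hz => by
      simp only [mem_reProdIm] at hz
      simp [uIcc_of_le hr0.le] at hz
      rw [uIcc_of_le (by linarith)] at hz
      exact ⟨hz.1.1, hz.2.1⟩)) (hGd.mono (fun z hz => by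
      simp only [mem_reProdIm] at hz
      simp [min_eq_left hr0.le, min_eq_left (by linarith : 0 ≤ 2 * r)] at hz
      exact ⟨hz.1.1, hz.2.1⟩))
  have hbound : ∀ z : ℂ, z ∈ closedQuadrant → r ≤ ‖z - r‖ → ‖G z‖ ≤ 2 / (r ^ 2 - 1) * M := by
    intro z hz h
    rw [hG, norm_mul]
    exact mul_le_mul (norm_halfPlaneFn_le_of_le hb (by simpa using hz.2) hr h) (hM z hz)
      (norm_nonneg _) (by positivity)
  simp only [zero_re, zero_im, add_re, add_im, ofReal_re, ofReal_im, re_ofReal_mul, im_ofReal_mul,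
    I_re, I_im, mul_zero, mul_one, add_zero, zero_add, ofReal_zero, zero_mul] at key
  have hbot : ∫ x : ℝ in 0..2 * r, G x = ∫ t in -r..r, halfPlaneFn b t * u t := by
    have h1 : ∫ x : ℝ in 0..2 * r, G x =
        ∫ x : ℝ in 0..2 * r, (fun t : ℝ => halfPlaneFn b t * u t) (x - r) := by
      refine intervalIntegral.integral_congr fun x hx => ?_
      rw [uIcc_of_le (by linarith)] at hx
      simp only [hG]
      rw [hfu x hx.1]; push_cast; rfl
    have h2 := intervalIntegral.integral_comp_sub_right (a := 0) (b := 2 * r)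
      (fun t : ℝ => halfPlaneFn b t * u t) r
    rw [h1, h2]
    congr 1 <;> ring
  have htop : ‖∫ x : ℝ in 0..2 * r, G (x + r * I)‖ ≤ 2 / (r ^ 2 - 1) * M * |2 * r - 0| := by
    refine intervalIntegral.norm_integral_le_of_norm_le_const fun x hx => ?_
    rw [uIoc_of_le (by linarith)] at hx
    refine hbound _ ⟨by simpa using hx.1.le, by simpa using hr0.le⟩ ?_
    refine le_trans ?_ (abs_im_le_norm _)
    simpa using le_abs_self r
  have hright : ‖∫ y : ℝ in 0..r, G ((2 * r : ℝ) + y * I)‖ ≤ 2 / (r ^ 2 - 1) * M * |r - 0| := by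
    refine intervalIntegral.norm_integral_le_of_norm_le_const fun y hy => ?_
    rw [uIoc_of_le hr0.le] at hy
    refine hbound _ ⟨by simpa using hr0.le, by simpa using hy.1.le⟩ ?_
    refine le_trans ?_ (abs_re_le_norm _)
    have : ((((2 * r : ℝ) : ℂ) + y * I) - r).re = r := by simp; ring
    rw [this]; exact le_abs_self r
  have hleft : ‖∫ y : ℝ in 0..r, G (y * I)‖ ≤ 2 / (r ^ 2 - 1) * M * |r - 0| := by
    refine intervalIntegral.norm_integral_le_of_norm_le_const fun y hy => ?_
    rw [uIoc_of_le hr0.le] at hy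
    refine hbound _ ⟨by simp, by simpa using hy.1.le⟩ ?_
    refine le_trans ?_ (abs_re_le_norm _)
    simpa using le_abs_self r
  rw [sub_zero, abs_of_pos (by linarith)] at htop
  rw [sub_zero, abs_of_pos hr0] at hright hleft
  have e : ∫ t in -r..r, halfPlaneFn b t * u t =
      (∫ x : ℝ in 0..2 * r, G (x + r * I)) - I • (∫ y : ℝ in 0..r, G ((2 * r : ℝ) + y * I)) +
        I • ∫ y : ℝ in 0..r, G (y * I) := by
    rw [← hbot]; linear_combination key
  rw [e]
  refine (norm_add_le _ _).trans ((add_le_add (norm_sub_le _ _) le_rfl).trans ?_)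
  rw [norm_smul, norm_smul, norm_I, one_mul, one_mul]
  calc _ ≤ 2 / (r ^ 2 - 1) * M * (2 * r) + 2 / (r ^ 2 - 1) * M * r + 2 / (r ^ 2 - 1) * M * r :=
        add_le_add (add_le_add htop hright) hleft
    _ = _ := by field_simp; ring

/-- A bounded continuous function on the line with bounded analytic extensions to all quadrants
`-r + {Re z ≥ 0, Im z ≥ 0}` is annihilated by `halfPlaneFn b`. -/
lemma integral_halfPlaneFn_mul_eq_zero {b : ℝ} (hb : 0 ≤ b) {u : ℝ → ℂ} {M : ℝ}
    (hc : Continuous u) (hM : ∀ t, ‖u t‖ ≤ M)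
    (hu : ∀ r : ℝ, 0 ≤ r → HasQuadrantExtension (fun t => u (t - r)) M) :
    ∫ t : ℝ, halfPlaneFn b t * u t = 0 := by
  have hint : Integrable fun t : ℝ => halfPlaneFn b t * u t :=
    (integrable_halfPlaneFn hb).mul_bdd (c := M) hc.aestronglyMeasurable
      (Eventually.of_forall hM)
  have h1 := intervalIntegral_tendsto_integral hint tendsto_neg_atTop_atBot tendsto_id
  have h2 : Tendsto (fun r : ℝ => r / (r ^ 2 - 1)) atTop (𝓝 0) := by
    have h3 : Tendsto (fun r : ℝ => (r - r⁻¹)⁻¹) atTop (𝓝 0) := by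
      refine tendsto_inv_atTop_zero.comp ?_
      simpa [sub_eq_add_neg] using tendsto_id.atTop_add tendsto_inv_atTop_zero.neg
    refine h3.congr' ?_
    filter_upwards [eventually_gt_atTop 1] with r hr
    have : r ^ 2 - 1 ≠ 0 := by nlinarith
    have h0 : r ≠ 0 := by linarith
    have : r - r⁻¹ = (r ^ 2 - 1) / r := by field_simp
    rw [this, inv_div]
  have h3 : Tendsto (fun r : ℝ => ∫ t in -r..r, halfPlaneFn b t * u t) atTop (𝓝 0) := by
    rw [tendsto_zero_iff_norm_tendsto_zero]
    have h4 := h2.const_mul (8 * M)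
    rw [mul_zero] at h4
    refine squeeze_zero' (Eventually.of_forall fun _ => norm_nonneg _) ?_ h4
    filter_upwards [eventually_gt_atTop 1] with r hr
    exact norm_integral_halfPlaneFn_mul_le hb hr (hu r (by linarith))
  exact tendsto_nhds_unique h1 h3

/-! ### Extending homomorphisms from a submonoid to a group -/

/-- A homomorphism on a submonoid whose left quotients exhaust the group extends to the group. -/
lemma exists_monoidHom_extend {G K : Type*} [Group G] [Group K] (S : Submonoid G)
    (hS : ∀ g : G, ∃ s ∈ S, s * g ∈ S) (V : S →* K) : ∃ U : G →* K, ∀ s : S, U s = V s := by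
  have hmul : ∀ {a b c : G} (ha : a ∈ S) (hb : b ∈ S) (hc : c ∈ S), a * b = c →
      V ⟨a, ha⟩ * V ⟨b, hb⟩ = V ⟨c, hc⟩ := by
    rintro a b _ ha hb hc rfl
    exact (V.map_mul _ _).symm
  choose d hd hdg using hS
  have hwd : ∀ (g s : G) (hs : s ∈ S) (hsg : s * g ∈ S),
      (V ⟨d g, hd g⟩)⁻¹ * V ⟨d g * g, hdg g⟩ = (V ⟨s, hs⟩)⁻¹ * V ⟨s * g, hsg⟩ := by
    -- The element u brings both fractions to a common denominator: u and u s (d g)⁻¹ lie in S, and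
    -- u s = (u s (d g)⁻¹)(d g).
    intro g s hs hsg
    set u := d (s * (d g)⁻¹) with hu
    have hus : u * s ∈ S := S.mul_mem (hd _) hs
    have husg : u * s * g ∈ S := by rw [mul_assoc]; exact S.mul_mem (hd _) hsg
    rw [inv_mul_eq_iff_eq_mul, ← mul_assoc, eq_comm]
    have e1 := hmul (hdg (s * (d g)⁻¹)) (hd g) hus (by rw [hu]; group)
    have e2 := hmul (hdg (s * (d g)⁻¹)) (hdg g) husg (by rw [hu]; group)
    have e3 := hmul (hd (s * (d g)⁻¹)) hs hus rfl
    have e4 := hmul (hd (s * (d g)⁻¹)) hsg husg (by rw [hu]; group)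
    have e5 := eq_inv_mul_of_mul_eq e1
    have e6 := eq_inv_mul_of_mul_eq e2
    rw [e5, e6, ← e3, ← e4]
    group
  refine ⟨MonoidHom.mk' (fun g => (V ⟨d g, hd g⟩)⁻¹ * V ⟨d g * g, hdg g⟩) fun g h => ?_,
    fun s => ?_⟩
  -- With v and v (d g) g (d h)⁻¹ both in S, v (d g) is a denominator for g h, and the middle
  -- factors of U(g)U(h) cancel.
  · set v := d (d g * g * (d h)⁻¹) with hv
    have hu : v * (d g * g * (d h)⁻¹) ∈ S := hdg _
    have e1 := hmul (hd (d g * g * (d h)⁻¹)) (hd g) (S.mul_mem (hd _) (hd _)) rfl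
    have hx : v * d g * g ∈ S := by rw [mul_assoc]; exact S.mul_mem (hd _) (hdg _)
    have e2 := hmul (hd (d g * g * (d h)⁻¹)) (hdg g) hx (by rw [hv]; group)
    have e3 := hmul hu (hd h) hx (by group)
    have hy : v * d g * (g * h) ∈ S := by
      have : v * d g * (g * h) = v * (d g * g * (d h)⁻¹) * (d h * h) := by group
      rw [this]; exact S.mul_mem hu (hdg h)
    have e4 := hmul hu (hdg h) hy (by group)
    rw [hwd (g * h) (v * d g) (S.mul_mem (hd _) (hd _)) hy, ← e1, ← e4]
    rw [eq_inv_mul_of_mul_eq e2, ← e3]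
    group
  · have := hwd s 1 S.one_mem (by rw [one_mul]; exact s.2)
    refine this.trans ?_
    have h1 : V ⟨1, S.one_mem⟩ = 1 := V.map_one
    rw [h1, inv_one, one_mul]
    congr 2
    exact one_mul _

/-! ### The cone and the semigroup -/

/-- The unit vector in the direction of time. -/
def timeVec : Spacetime := ![1, 0, 0, 0]

lemma timeVec_mem : timeVec ∈ forwardCone := by simp [forwardCone, mdot_eq, timeVec]

lemma isOpen_forwardCone : IsOpen forwardCone := by
  have h : Continuous fun x : Spacetime => mdot x x := by
    simp only [mdot_eq]
    fun_prop
  exact (isOpen_lt continuous_const (continuous_apply 0)).inter (isOpen_lt continuous_const h)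

lemma mdot_smul_smul (s : ℝ) (x : Spacetime) : mdot (s • x) (s • x) = s ^ 2 * mdot x x := by
  simp only [mdot_eq, Pi.smul_apply, smul_eq_mul]; ring

lemma smul_mem_closedForwardCone {s : ℝ} (hs : 0 ≤ s) {x : Spacetime}
    (hx : x ∈ closedForwardCone) : s • x ∈ closedForwardCone :=
  ⟨mul_nonneg hs hx.1, by rw [mdot_smul_smul]; exact mul_nonneg (sq_nonneg s) hx.2⟩

lemma smul_mem_forwardCone {s : ℝ} (hs : 0 < s) {x : Spacetime}
    (hx : x ∈ forwardCone) : s • x ∈ forwardCone :=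
  ⟨mul_pos hs hx.1, by rw [mdot_smul_smul]; exact mul_pos (pow_pos hs 2) hx.2⟩

/-- Every vector can be moved into the forward cone by a future directed translation. -/
lemma exists_smul_timeVec_add_mem (x : Spacetime) :
    ∃ c : ℝ, 0 ≤ c ∧ c • timeVec + x ∈ forwardCone := by
  -- The new time component strictly exceeds the ℓ¹ norm of the spatial part, which dominates its
  -- Euclidean norm.
  refine ⟨1 + |x 0| + (|x 1| + |x 2| + |x 3|), by positivity, ?_, ?_⟩
  · simp [timeVec]
    linarith [neg_abs_le (x 0), abs_nonneg (x 1), abs_nonneg (x 2), abs_nonneg (x 3)]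
  · have h : (|x 1| + |x 2| + |x 3|) < 1 + |x 0| + (|x 1| + |x 2| + |x 3|) + x 0 := by
      linarith [neg_abs_le (x 0)]
    have h1 := abs_nonneg (x 1)
    have h2 := abs_nonneg (x 2)
    have h3 := abs_nonneg (x 3)
    have h4 := pow_lt_pow_left₀ h (by positivity) two_ne_zero
    rw [mdot_eq]
    simp [timeVec]
    nlinarith [sq_abs (x 1), sq_abs (x 2), sq_abs (x 3), mul_nonneg h1 h2, mul_nonneg h1 h3,
      mul_nonneg h2 h3]

/-- Translations along a half-line; for negative parameters this is the identity. -/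
def Semi.dilation {e : Spacetime} (he : e ∈ forwardCone) (t : ℝ) : Semi :=
  Semi.translation (max t 0 • e)
    (smul_mem_closedForwardCone (le_max_right t 0) (forwardCone_subset_closed he))

lemma Poincare.translation_add (x y : Spacetime) :
    Poincare.translation (x + y) = Poincare.translation x * Poincare.translation y := by
  refine SemidirectProduct.ext ?_ ?_
  · simp [Poincare.translation]
  · simp [Poincare.translation]

lemma Poincare.translation_zero : Poincare.translation 0 = 1 := rfl

lemma Poincare.shift_mul (g h : Poincare) :
    (g * h).shift = g.shift + lorentzApply g.right h.shift := rfl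

lemma Poincare.continuous_coords :
    Continuous fun g : Poincare => ((g.left.toAdd, g.right) : Spacetime × Lorentz) :=
  continuous_induced_dom

lemma continuous_shift : Continuous Poincare.shift :=
  continuous_fst.comp Poincare.continuous_coords

lemma Poincare.continuous_translation_mul (x : Spacetime) :
    Continuous fun g : Poincare => Poincare.translation x * g := by
  refine continuous_induced_rng.mpr ?_
  have : (fun g : Poincare => (g.left.toAdd, g.right)) ∘ (fun g => Poincare.translation x * g) =
      fun g : Poincare => (x + g.shift, g.right) := by
    funext g
    refine Prod.ext ?_ ?_
    · show x + lorentzApply 1 g.shift = _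
      rw [lorentzApply_one]
    · exact one_mul _
  rw [this]
  exact (continuous_const.add continuous_shift).prodMk
    (continuous_snd.comp Poincare.continuous_coords)

lemma Poincare.continuous_translation : Continuous Poincare.translation :=
  continuous_induced_rng.mpr (continuous_id.prodMk continuous_const)

lemma Poincare.shift_translation_mul (x : Spacetime) (g : Poincare) :
    (Poincare.translation x * g).shift = x + g.shift := by
  rw [Poincare.shift_mul]
  show x + lorentzApply 1 g.shift = _
  rw [lorentzApply_one]

/-- The semigroup generates the Poincaré group. -/
lemma exists_translation_mul_mem (g : Poincare) : ∃ s ∈ Semi, s * g ∈ Semi := by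
  obtain ⟨c, hc0, hcg⟩ := exists_smul_timeVec_add_mem g.shift
  refine ⟨Poincare.translation (c • timeVec),
    smul_mem_closedForwardCone hc0 (forwardCone_subset_closed timeVec_mem), ?_⟩
  show (Poincare.translation (c • timeVec) * g).shift ∈ closedForwardCone
  rw [Poincare.shift_translation_mul]
  exact forwardCone_subset_closed hcg

/-! ### Unitarity and extension to the Poincaré group -/

/-- Analytic matrix elements of isometries for a dense set of vectors yield analytic matrix
elements for all vectors. -/
lemma hasQuadrantExtension_inner_of_dense {H : Type*} [NormedAddCommGroup H]
    [InnerProductSpace ℂ H] {T : ℝ → H →L[ℂ] H} (hT : ∀ t ψ, ‖T t ψ‖ = ‖ψ‖)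
    {D : AddSubgroup H} (hD : Dense (D : Set H))
    (h : ∀ a ∈ D, ∀ b ∈ D, HasQuadrantExtension (fun t => ⟪a, T t b⟫_ℂ) (‖a‖ * ‖b‖)) (φ ψ : H) :
    HasQuadrantExtension (fun t => ⟪φ, T t ψ⟫_ℂ) (‖φ‖ * ‖ψ‖) := by
  -- One slot at a time. The first slot is conjugate-linear, so only additivity can be asked of
  -- both.
  have h1 : ∀ b ∈ D, HasQuadrantExtension (fun t => ⟪φ, T t b⟫_ℂ) (‖b‖ * ‖φ‖) := fun b hb =>
    hasQuadrantExtension_of_dense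
      (L := fun t => AddMonoidHom.mk' (fun φ => ⟪φ, T t b⟫_ℂ) fun _ _ => inner_add_left _ _ _)
      (fun t _ φ => (norm_inner_le_norm _ _).trans_eq (by rw [hT, mul_comm])) hD
      (fun a ha => by rw [mul_comm]; exact h a ha b hb) φ
  exact hasQuadrantExtension_of_dense
    (L := fun t => AddMonoidHom.mk' (fun ψ => ⟪φ, T t ψ⟫_ℂ)
      fun _ _ => by rw [map_add, inner_add_right])
    (fun t _ ψ => (norm_inner_le_norm _ _).trans_eq (by rw [hT])) hD
    (fun b hb => by rw [mul_comm]; exact h1 b hb) ψ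

section Representation

variable {H : Type*} [NormedAddCommGroup H] [InnerProductSpace ℂ H] [CompleteSpace H]

/-- An isometric representation of the semigroup with analytic matrix elements is unitary. -/
lemma mem_unitary_of_hasQuadrantExtension (V : Semi →* (H →L[ℂ] H))
    (hV : ∀ g, star (V g) * V g = 1)
    (hQ : ∀ (e : Spacetime) (he : e ∈ forwardCone) (φ ψ : H),
      HasQuadrantExtension (fun t => ⟪φ, V (Semi.dilation he t) ψ⟫_ℂ) (‖φ‖ * ‖ψ‖)) (g : Semi) :
    V g ∈ unitary (H →L[ℂ] H) := by
  have htr : ∀ (e : Spacetime) (he : e ∈ forwardCone) (ψ : H),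
      (∀ χ, ⟪ψ, V (Semi.dilation he 1) χ⟫_ℂ = 0) → ψ = 0 := by
    intro e he ψ hψ
    have h := (hQ e he ψ ψ).eq_zero zero_le_one (fun t ht => by
      have e1 : Semi.dilation he t = Semi.dilation he 1 * Semi.dilation he (t - 1) := by
        refine Subtype.ext ?_
        show Poincare.translation _ = Poincare.translation _ * Poincare.translation _
        rw [← Poincare.translation_add, ← add_smul, max_eq_left (by linarith),
          max_eq_left zero_le_one, max_eq_left (by linarith), add_sub_cancel]
      rw [e1, map_mul]
      exact hψ _) le_rfl
    have e0 : Semi.dilation he 0 = 1 := by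
      refine Subtype.ext ?_
      show Poincare.translation _ = 1
      rw [max_self, zero_smul, Poincare.translation_zero]
    rw [e0, map_one] at h
    exact inner_self_eq_zero.mp h
  -- With g = (x, Λ) and e₀ = `timeVec`, the translation by x + e₀ is g (Λ⁻¹e₀, Λ⁻¹), so its range
  -- lies in that of V(g). Adding e₀ makes the direction timelike even if x is lightlike or zero.
  have hdense : ∀ ψ : H, (∀ χ, ⟪ψ, V g χ⟫_ℂ = 0) → ψ = 0 := by
    intro ψ hψ
    have he : g.val.shift + timeVec ∈ forwardCone := add_mem_forwardCone g.2 timeVec_mem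
    refine htr _ he ψ fun χ => ?_
    have hk : (⟨Multiplicative.ofAdd (lorentzApply g.val.right⁻¹ timeVec), g.val.right⁻¹⟩ :
        Poincare) ∈ Semi :=
      forwardCone_subset_closed (lorentzApply_mem_forwardCone _ timeVec_mem)
    have e1 : Semi.dilation he 1 = g * ⟨_, hk⟩ := by
      refine Subtype.ext (SemidirectProduct.ext ?_ ?_)
      · show (max 1 0 : ℝ) • (g.val.shift + timeVec) =
          g.val.shift + lorentzApply g.val.right (lorentzApply g.val.right⁻¹ timeVec)
        rw [← lorentzApply_mul, mul_inv_cancel, lorentzApply_one, max_eq_left zero_le_one,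
          one_smul]
      · exact (mul_inv_cancel g.val.right).symm
    rw [e1, map_mul]
    exact hψ _
  refine Unitary.mem_iff.mpr ⟨hV g, ?_⟩
  ext y
  rw [one_apply_eq_self, eq_comm, ← sub_eq_zero]
  -- Since V*V = 1, the vector y - VV*y is orthogonal to the range of V.
  refine hdense _ fun χ => ?_
  have h1 : ⟪(V g * star (V g)) y, V g χ⟫_ℂ = ⟪y, V g χ⟫_ℂ := by
    have h2 : (star (V g)) (V g χ) = χ := congrArg (fun T : H →L[ℂ] H => T χ) (hV g)
    have h3 : ∀ a b : H, ⟪V g a, b⟫_ℂ = ⟪a, star (V g) b⟫_ℂ := fun a b => by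
      rw [ContinuousLinearMap.star_eq_adjoint, ContinuousLinearMap.adjoint_inner_right]
    rw [mul_apply_eq_comp, h3, h2, ContinuousLinearMap.star_eq_adjoint,
      ContinuousLinearMap.adjoint_inner_left]
  rw [inner_sub_left, h1, sub_self]

/-- A strongly continuous unitary representation of the semigroup extends to the Poincaré
group. -/
lemma exists_unitary_extension (V : Semi →* unitary (H →L[ℂ] H))
    (hc : ∀ ψ : H, Continuous fun g : Semi => (V g : H →L[ℂ] H) ψ) :
    ∃ U : Poincare →* unitary (H →L[ℂ] H), (∀ g : Semi, U g = V g) ∧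
      ∀ ψ : H, Continuous fun g : Poincare => (U g : H →L[ℂ] H) ψ := by
  obtain ⟨U, hU⟩ := exists_monoidHom_extend Semi exists_translation_mul_mem V
  refine ⟨U, hU, fun ψ => continuous_iff_continuousAt.mpr fun g₀ => ?_⟩
  obtain ⟨c, hc0, hcg⟩ := exists_smul_timeVec_add_mem g₀.shift
  set s := Poincare.translation (c • timeVec) with hs
  set W : Set Poincare := {g | c • timeVec + g.shift ∈ forwardCone} with hW
  have hWo : IsOpen W := isOpen_forwardCone.preimage (continuous_const.add continuous_shift)
  have hWS : ∀ g ∈ W, s * g ∈ Semi := fun g hg => by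
    show (s * g).shift ∈ closedForwardCone
    rw [Poincare.shift_translation_mul]
    exact forwardCone_subset_closed hg
  -- On W one has U(g) = U(s)* V(sg) with s fixed.
  have hcont : ContinuousOn (fun g : Poincare => (U g : H →L[ℂ] H) ψ) W := by
    rw [continuousOn_iff_continuous_domRestrict]
    have h1 : Continuous fun g : W => (⟨s * g, hWS g g.2⟩ : Semi) :=
      ((Poincare.continuous_translation_mul _).comp continuous_subtype_val).subtype_mk _
    have h2 := (star (U s : H →L[ℂ] H)).continuous.comp ((hc ψ).comp h1)
    refine h2.congr fun g => ?_
    simp only [Function.comp_apply, domRestrict_apply]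
    rw [← hU]
    simp only [map_mul, Submonoid.coe_mul]
    rw [← mul_apply_eq_comp, ← mul_assoc, Unitary.coe_star_mul_self, one_mul]
  exact hcont.continuousAt (hWo.mem_nhds hcg)

end Representation

/-! ### Spectrum -/

/-- Vectors outside the closed forward cone have negative product with some vector in the open
forward cone. -/
lemma exists_mdot_neg {p : Spacetime} (hp : p ∉ closedForwardCone) :
    ∃ e ∈ forwardCone, mdot p e < 0 := by
  by_cases h0 : 0 ≤ p 0
  · have hm : mdot p p < 0 := by
      by_contra h
      exact hp ⟨h0, not_lt.mp h⟩
    rw [mdot_eq] at hm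
    set r := √(p 1 ^ 2 + p 2 ^ 2 + p 3 ^ 2) with hr
    have hr2 : r ^ 2 = p 1 ^ 2 + p 2 ^ 2 + p 3 ^ 2 := Real.sq_sqrt (by positivity)
    have hpr : p 0 < r := lt_of_pow_lt_pow_left₀ 2 (Real.sqrt_nonneg _) (by rw [hr2]; linarith)
    have hr0 : 0 < r := h0.trans_lt hpr
    -- For p₀ > 0 this is the harmonic mean of r and r²/p₀: E > r makes e = (E, 𝐩) timelike, and p₀E
    -- < r² makes p·e negative. The formula also covers p₀ = 0.
    set E := 2 * r ^ 2 / (p 0 + r) with hE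
    have hEr : r < E := by
      rw [hE, lt_div_iff₀ (by positivity)]; nlinarith
    have hpE : p 0 * E < r ^ 2 := by
      rw [hE, mul_div_assoc', div_lt_iff₀ (by positivity)]
      nlinarith [mul_pos hr0 hr0]
    refine ⟨![E, p 1, p 2, p 3], ⟨?_, ?_⟩, ?_⟩
    · simpa using hr0.trans hEr
    · rw [mdot_eq]; simp
      nlinarith
    · rw [mdot_eq]; simp
      nlinarith
  · refine ⟨timeVec, timeVec_mem, ?_⟩
    simpa [mdot_eq, timeVec] using h0

lemma mdot_add_right (p x y : Spacetime) : mdot p (x + y) = mdot p x + mdot p y := by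
  simp only [mdot_eq, Pi.add_apply]; ring

lemma mdot_smul_right (p : Spacetime) (t : ℝ) (x : Spacetime) :
    mdot p (t • x) = t * mdot p x := by
  simp only [mdot_eq, Pi.smul_apply, smul_eq_mul]; ring

lemma continuous_mdot_right (p : Spacetime) : Continuous fun x => mdot p x := by
  simp only [mdot_eq]; fun_prop

/-- The convolution of a function `k` on Minkowski space with a function `h` of one variable in
the direction `e`. -/
noncomputable def smear (h : ℝ → ℂ) (e : Spacetime) (k : Spacetime → ℂ) (x : Spacetime) : ℂ :=
  ∫ t, h t * k (x - t • e)

section Smear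

variable {h : ℝ → ℂ} {k : Spacetime → ℂ}

/-- The shear (t, x) ↦ (t, x - te) preserves the product measure and pulls h ⊗ k back to this
kernel. -/
lemma integrable_smear_kernel (hh : Integrable h) (hk : Integrable k) (e : Spacetime) :
    Integrable (fun z : ℝ × Spacetime => h z.1 * k (z.2 - z.1 • e))
      ((volume : Measure ℝ).prod (volume : Measure Spacetime)) := by
  have h1 : MeasurePreserving (fun z : ℝ × Spacetime => (z.1, z.2 - z.1 • e))
      ((volume : Measure ℝ).prod (volume : Measure Spacetime))
      ((volume : Measure ℝ).prod (volume : Measure Spacetime)) :=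
    (MeasurePreserving.id _).skew_product (g := fun t x => x - t • e)
      (by fun_prop) (Eventually.of_forall fun t => by
        exact (measurePreserving_sub_right volume (t • e)).map_eq)
  exact h1.integrable_comp_of_integrable (hh.mul_prod hk)

lemma integrable_smear (hh : Integrable h) (hk : Integrable k) (e : Spacetime) :
    Integrable (smear h e k) :=
  (integrable_smear_kernel hh hk e).integral_prod_right

/-- Fubini and the substitution x = y + te move the smearing onto w. It serves both for matrix
elements of U and for the character exp(i p·x). -/
lemma integral_smear_mul (hh : Integrable h) (hk : Integrable k) (e : Spacetime)
    {w : Spacetime → ℂ} (hw : Continuous w) {C : ℝ} (hC : ∀ x, ‖w x‖ ≤ C) :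
    ∫ x, smear h e k x * w x = ∫ y, k y * ∫ t, h t * w (y + t • e) := by
  have h1 : Integrable (fun z : ℝ × Spacetime => h z.1 * k (z.2 - z.1 • e) * w z.2)
      ((volume : Measure ℝ).prod (volume : Measure Spacetime)) :=
    (integrable_smear_kernel hh hk e).mul_bdd (c := C)
      (hw.comp continuous_snd).aestronglyMeasurable (Eventually.of_forall fun z => hC z.2)
  have h2 : Integrable (fun z : ℝ × Spacetime => h z.1 * k z.2 * w (z.2 + z.1 • e))
      ((volume : Measure ℝ).prod (volume : Measure Spacetime)) :=
    (hh.mul_prod hk).mul_bdd (c := C)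
      (hw.comp (by fun_prop)).aestronglyMeasurable (Eventually.of_forall fun z => hC _)
  calc ∫ x, smear h e k x * w x = ∫ x, ∫ t, h t * k (x - t • e) * w x := by
        simp only [smear, integral_mul_const]
    _ = ∫ t, ∫ x, h t * k (x - t • e) * w x := (integral_integral_swap h1).symm
    _ = ∫ t, ∫ y, h t * k y * w (y + t • e) := by
        refine integral_congr_ae (Eventually.of_forall fun t => ?_)
        have := integral_sub_right_eq_self (μ := (volume : Measure Spacetime))
          (fun y => h t * k y * w (y + t • e)) (t • e)
        simpa only [sub_add_cancel] using this
    _ = ∫ y, ∫ t, h t * k y * w (y + t • e) := integral_integral_swap h2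
    _ = ∫ y, k y * ∫ t, h t * w (y + t • e) := by
        refine integral_congr_ae (Eventually.of_forall fun y => ?_)
        simp only
        rw [← integral_const_mul]
        refine integral_congr_ae (Eventually.of_forall fun t => ?_)
        ring

end Smear

lemma integral_indicator_exp_mul_exp (p : Spacetime) :
    ∫ y, (Icc (0 : Spacetime) 1).indicator (fun y => exp (-(I * (mdot p y : ℂ)))) y *
      exp (I * (mdot p y : ℂ)) = 1 := by
  have e : (fun y => (Icc (0 : Spacetime) 1).indicator (fun y => exp (-(I * (mdot p y : ℂ)))) y *
      exp (I * (mdot p y : ℂ))) = (Icc (0 : Spacetime) 1).indicator fun _ => (1 : ℂ) := by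
    funext y
    by_cases hy : y ∈ Icc (0 : Spacetime) 1
    · simp [indicator_of_mem hy, ← exp_add]
    · simp [indicator_of_notMem hy]
  rw [e, integral_indicator measurableSet_Icc]
  simp [Measure.real, Real.volume_Icc_pi]

section Representation

variable {H : Type*} [NormedAddCommGroup H] [InnerProductSpace ℂ H] [CompleteSpace H]

/-- A unitary representation of the translations with matrix elements analytic in the forward
directions satisfies the spectrum condition. -/
lemma translationSpectrum_subset (U : Poincare →* unitary (H →L[ℂ] H))
    (hc : ∀ ψ : H, Continuous fun g : Poincare => (U g : H →L[ℂ] H) ψ)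
    (hQ : ∀ e ∈ forwardCone, ∀ φ ψ : H, HasQuadrantExtension
      (fun t => ⟪φ, (U (Poincare.translation (t • e)) : H →L[ℂ] H) ψ⟫_ℂ) (‖φ‖ * ‖ψ‖)) :
    translationSpectrum (fun x => (U (Poincare.translation x) : H →L[ℂ] H)) ⊆
      closedForwardCone := by
  intro p hp
  by_contra hpc
  obtain ⟨e, he, hpe⟩ := exists_mdot_neg hpc
  have hnorm : ∀ (g : Poincare) (ψ : H), ‖(U g : H →L[ℂ] H) ψ‖ = ‖ψ‖ := fun g ψ =>
    (Unitary.linearIsometryEquiv (U g)).norm_map ψ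
  have hadd : ∀ (x y : Spacetime) (φ ψ : H),
      ⟪φ, (U (Poincare.translation (x + y)) : H →L[ℂ] H) ψ⟫_ℂ =
        ⟪star (U (Poincare.translation x) : H →L[ℂ] H) φ,
          (U (Poincare.translation y) : H →L[ℂ] H) ψ⟫_ℂ := by
    intro x y φ ψ
    rw [Poincare.translation_add, map_mul, Submonoid.coe_mul, mul_apply_eq_comp,
      ContinuousLinearMap.star_eq_adjoint, ContinuousLinearMap.adjoint_inner_left]
  have hnorm' : ∀ (g : Poincare) (ψ : H), ‖star (U g : H →L[ℂ] H) ψ‖ = ‖ψ‖ := fun g ψ =>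
    (Unitary.linearIsometryEquiv (star (U g))).norm_map ψ
  have hcU : ∀ ψ : H, Continuous fun x => (U (Poincare.translation x) : H →L[ℂ] H) ψ := fun ψ =>
    (hc ψ).comp Poincare.continuous_translation
  set b := -mdot p e with hb
  have hb0 : 0 < b := by linarith
  have hh := integrable_halfPlaneFn hb0.le
  set k : Spacetime → ℂ :=
    (Icc (0 : Spacetime) 1).indicator (fun y => exp (-(I * (mdot p y : ℂ)))) with hkdef
  have hexpc : Continuous fun y => exp (I * (mdot p y : ℂ)) := by
    have := continuous_mdot_right p
    fun_prop
  have hk : Integrable k := by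
    rw [hkdef, integrable_indicator_iff measurableSet_Icc]
    refine ContinuousOn.integrableOn_compact isCompact_Icc ?_
    have := continuous_mdot_right p
    fun_prop
  have hzero := hp (smear (fun t => halfPlaneFn b t) e k) (integrable_smear hh hk e) (by
    intro φ ψ
    rw [integral_smear_mul hh hk e (C := ‖φ‖ * ‖ψ‖) (continuous_const.inner (hcU ψ))
      (fun x => (norm_inner_le_norm _ _).trans (by rw [hnorm]))]
    refine integral_eq_zero_of_ae (Eventually.of_forall fun y => ?_)
    simp only [Pi.zero_apply]
    rw [integral_halfPlaneFn_mul_eq_zero hb0.le (M := ‖φ‖ * ‖ψ‖), mul_zero]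
    · exact continuous_const.inner ((hcU ψ).comp (by fun_prop))
    · exact fun t => (norm_inner_le_norm _ _).trans (by rw [hnorm])
    -- The backward shift is absorbed into φ: ⟨φ, U(y + (t - r)e)ψ⟩ = ⟨U(y - re)*φ, U(te)ψ⟩, with
    -- the same bound because the adjoint is isometric. This requires U on the whole group.
    · intro r _
      have h1 := hQ e he (star (U (Poincare.translation (y - r • e)) : H →L[ℂ] H) φ) ψ
      rw [hnorm'] at h1
      convert h1 using 2 with t
      rw [← hadd, sub_smul]
      congr 5
      abel)
  rw [integral_smear_mul hh hk e hexpc (C := 1) (fun x => by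
    rw [mul_comm, norm_exp_ofReal_mul_I])] at hzero
  -- The character splits as p·(y + te) = p·y - bt, and k was chosen so that the y-integral is 1.
  have e1 : ∀ y, ∫ t : ℝ, halfPlaneFn b t * exp (I * (mdot p (y + t • e) : ℂ)) =
      exp (I * (mdot p y : ℂ)) * ∫ t : ℝ, halfPlaneFn b t * exp (I * (-b * t : ℝ)) := by
    intro y
    rw [← integral_const_mul]
    refine integral_congr_ae (Eventually.of_forall fun t => ?_)
    simp only
    rw [mul_left_comm, ← exp_add, mdot_add_right, mdot_smul_right, hb]
    congr 2
    push_cast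
    ring
  simp only [e1, ← mul_assoc] at hzero
  rw [integral_mul_const, hkdef, integral_indicator_exp_mul_exp, one_mul] at hzero
  exact integral_halfPlaneFn_mul_exp_ne_zero hb0 hzero

end Representation

/-! ### The GNS representation of a vacuum state -/

section GNS

variable {A : Type*} [CStarAlgebra A] [PartialOrder A] [StarOrderedRing A]
  {N : LocalNet A} {ω : A →ₚ[ℂ] ℂ}

/-- The vector of the GNS space determined by an element of the algebra. -/
noncomputable def gnsClass (ω : A →ₚ[ℂ] ℂ) (a : A) : ω.GNS := (ω.toPreGNS a : ω.PreGNS)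

lemma inner_gnsClass (a b : A) : ⟪gnsClass ω a, gnsClass ω b⟫_ℂ = ω (star a * b) := by
  rw [gnsClass, gnsClass, Completion.inner_coe]; rfl

lemma norm_gnsClass (a : A) : ‖gnsClass ω a‖ = √(ω (star a * a)).re := by
  rw [gnsClass, Completion.norm_coe]; rfl

lemma gnsStarAlgHom_gnsClass (a b : A) :
    ω.gnsStarAlgHom a (gnsClass ω b) = gnsClass ω (a * b) := by
  simp [gnsClass]

lemma gnsStarAlgHom_gnsVector (a : A) : ω.gnsStarAlgHom a (gnsVector ω) = gnsClass ω a := by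
  rw [← mul_one a, ← gnsStarAlgHom_gnsClass, mul_one]; rfl

/-- The vectors `gnsClass ω a`, as a subgroup of the GNS space. -/
noncomputable def gnsRange (ω : A →ₚ[ℂ] ℂ) : AddSubgroup ω.GNS where
  carrier := range (gnsClass ω)
  zero_mem' := ⟨0, by rw [gnsClass, map_zero]; exact Completion.coe_zero⟩
  add_mem' := by
    rintro _ _ ⟨a, rfl⟩ ⟨b, rfl⟩
    exact ⟨a + b, by simp [gnsClass, Completion.coe_add]⟩
  neg_mem' := by
    rintro _ ⟨a, rfl⟩
    exact ⟨-a, by simp [gnsClass, Completion.coe_neg]⟩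

lemma denseRange_gnsClass (ω : A →ₚ[ℂ] ℂ) : DenseRange (gnsClass ω) :=
  Completion.denseRange_coe.comp ω.toPreGNS.surjective.denseRange (Completion.continuous_coe _)

lemma eq_of_eq_on_gnsClass {S T : ω.GNS →L[ℂ] ω.GNS}
    (h : ∀ a, S (gnsClass ω a) = T (gnsClass ω a)) : S = T :=
  ContinuousLinearMap.ext fun x => congrFun
    ((denseRange_gnsClass ω).equalizer S.continuous T.continuous (funext h)) x

lemma IsVacuumState.norm_toPreGNS_endo (hω : IsVacuumState N ω) (g : Semi) (a : ω.PreGNS) :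
    ‖ω.toPreGNS (N.endo g (ω.ofPreGNS a))‖ = ‖a‖ := by
  rw [PositiveLinearMap.preGNS_norm_def, PositiveLinearMap.preGNS_norm_def,
    PositiveLinearMap.ofPreGNS_toPreGNS, ← map_star, ← map_mul, hω.invariant]

/-- The isometry of the GNS space implementing an endomorphism which preserves the state. -/
noncomputable def vacuumIsometry (hω : IsVacuumState N ω) (g : Semi) : ω.GNS →L[ℂ] ω.GNS :=
  ((ω.toPreGNS.toLinearMap ∘ₗ (N.endo g).toAlgHom.toLinearMap ∘ₗ
    ω.ofPreGNS.toLinearMap).mkContinuous 1 fun a => by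
      rw [one_mul]; exact (hω.norm_toPreGNS_endo g a).le).completion

lemma vacuumIsometry_gnsClass (hω : IsVacuumState N ω) (g : Semi) (a : A) :
    vacuumIsometry hω g (gnsClass ω a) = gnsClass ω (N.endo g a) :=
  ContinuousLinearMap.completion_apply_coe _ _

/-- The isometric representation of the semigroup on the GNS space of a vacuum state. -/
noncomputable def vacuumRep (hω : IsVacuumState N ω) : Semi →* (ω.GNS →L[ℂ] ω.GNS) where
  toFun := vacuumIsometry hω
  map_one' := eq_of_eq_on_gnsClass fun a => by
    rw [vacuumIsometry_gnsClass, map_one]; rfl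
  map_mul' g h := eq_of_eq_on_gnsClass fun a => by
    rw [mul_apply_eq_comp, vacuumIsometry_gnsClass, vacuumIsometry_gnsClass,
      vacuumIsometry_gnsClass, map_mul]; rfl

lemma vacuumRep_gnsClass (hω : IsVacuumState N ω) (g : Semi) (a : A) :
    vacuumRep hω g (gnsClass ω a) = gnsClass ω (N.endo g a) := vacuumIsometry_gnsClass hω g a

lemma star_vacuumRep_mul_self (hω : IsVacuumState N ω) (g : Semi) :
    star (vacuumRep hω g) * vacuumRep hω g = 1 := by
  refine eq_of_eq_on_gnsClass fun a => (denseRange_gnsClass ω).eq_of_inner_left (𝕜 := ℂ) fun b => ?_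
  rw [mul_apply_eq_comp, ContinuousLinearMap.star_eq_adjoint,
    ContinuousLinearMap.adjoint_inner_left, vacuumRep_gnsClass, vacuumRep_gnsClass,
    inner_gnsClass, ← map_star, ← map_mul, hω.invariant, one_apply_eq_self, inner_gnsClass]

lemma norm_vacuumRep_apply (hω : IsVacuumState N ω) (g : Semi) (ψ : ω.GNS) :
    ‖vacuumRep hω g ψ‖ = ‖ψ‖ :=
  (ContinuousLinearMap.norm_map_iff_adjoint_comp_self _).mpr (star_vacuumRep_mul_self hω g) ψ

/-- For isometries weak continuity implies strong continuity, as ‖V(g)ψ - V(g₀)ψ‖² = 2‖ψ‖² - 2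
Re⟨V(g₀)ψ, V(g)ψ⟩. General vectors follow by approximation, uniform in g. -/
lemma continuous_vacuumRep_apply (hω : IsVacuumState N ω) (ψ : ω.GNS) :
    Continuous fun g => vacuumRep hω g ψ := by
  have hcore : ∀ a : A, Continuous fun g => vacuumRep hω g (gnsClass ω a) := by
    intro a
    refine continuous_iff_continuousAt.mpr fun g₀ => ?_
    rw [ContinuousAt, tendsto_iff_norm_sub_tendsto_zero]
    have hsq : ∀ g, ‖vacuumRep hω g (gnsClass ω a) - vacuumRep hω g₀ (gnsClass ω a)‖ =
        √(2 * ‖gnsClass ω a‖ ^ 2 - 2 * (ω (star (N.endo g₀ a) * N.endo g a)).re) := by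
      intro g
      rw [← Real.sqrt_sq (norm_nonneg (_ - _)), norm_sub_rev, @norm_sub_sq ℂ,
        norm_vacuumRep_apply, norm_vacuumRep_apply, vacuumRep_gnsClass, vacuumRep_gnsClass,
        inner_gnsClass]
      congr 1
      simp only [RCLike.re_eq_complex_re]
      ring
    simp only [hsq]
    have hcont : Continuous fun g =>
        √(2 * ‖gnsClass ω a‖ ^ 2 - 2 * (ω (star (N.endo g₀ a) * N.endo g a)).re) := by
      exact (continuous_const.sub (continuous_const.mul
        (continuous_re.comp (hω.continuous (N.endo g₀ a) a)))).sqrt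
    have h := hcont.tendsto g₀
    rwa [← hsq, sub_self, norm_zero] at h
  refine continuous_of_uniform_approx_of_continuous fun u hu => ?_
  obtain ⟨ε, hε, hεu⟩ := Metric.mem_uniformity_dist.mp hu
  obtain ⟨a, ha⟩ := (denseRange_gnsClass ω).exists_dist_lt ψ hε
  refine ⟨_, hcore a, fun g => hεu ?_⟩
  rwa [dist_eq_norm, ← map_sub, norm_vacuumRep_apply, ← dist_eq_norm]

lemma smul_mem_complexCone {e : Spacetime} (he : e ∈ forwardCone) {z : ℂ}
    (hz : z ∈ closedQuadrant) : (fun i => z * (e i : ℂ)) ∈ complexCone := by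
  have h := forwardCone_subset_closed he
  refine ⟨?_, ?_⟩
  · convert smul_mem_closedForwardCone hz.1 h using 1
    funext i; simp
  · convert smul_mem_closedForwardCone hz.2 h using 1
    funext i; simp

lemma smul_mem_interior_complexCone {e : Spacetime} (he : e ∈ forwardCone) {z : ℂ}
    (hz : z ∈ openQuadrant) : (fun i => z * (e i : ℂ)) ∈ interior complexCone := by
  have hsub : {z : Fin 4 → ℂ | (fun i => (z i).re) ∈ forwardCone ∧
      (fun i => (z i).im) ∈ forwardCone} ⊆ complexCone :=
    fun z hz => ⟨forwardCone_subset_closed hz.1, forwardCone_subset_closed hz.2⟩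
  refine interior_maximal hsub ?_ ⟨?_, ?_⟩
  · have h1 : Continuous fun (z : Fin 4 → ℂ) i => (z i).re := by fun_prop
    have h2 : Continuous fun (z : Fin 4 → ℂ) i => (z i).im := by fun_prop
    exact (isOpen_forwardCone.preimage h1).inter (isOpen_forwardCone.preimage h2)
  · convert smul_mem_forwardCone hz.1 he using 1
    funext i; simp
  · convert smul_mem_forwardCone hz.2 he using 1
    funext i; simp

/-- Restrict F to the complex line z ↦ z e. Because e is strictly timelike, the open quadrant lands
in the interior of the complex cone, where F is analytic. -/
lemma hasQuadrantExtension_gnsClass (hω : IsVacuumState N ω) {e : Spacetime}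
    (he : e ∈ forwardCone) (a b : A) : HasQuadrantExtension
      (fun t => ⟪gnsClass ω a, vacuumRep hω (Semi.dilation he t) (gnsClass ω b)⟫_ℂ)
      (‖gnsClass ω a‖ * ‖gnsClass ω b‖) := by
  obtain ⟨F, hFc, hFa, hFb, hF⟩ := hω.analytic a b
  refine ⟨fun z => F fun i => z * (e i : ℂ), hFc.comp (by fun_prop) fun z hz =>
    smul_mem_complexCone he hz, ?_, fun z hz => ?_, fun t ht => ?_⟩
  · exact hFa.differentiableOn.comp (by fun_prop) fun z hz =>
      smul_mem_interior_complexCone he hz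
  · refine (hFb _ (smul_mem_complexCone he hz)).trans_eq ?_
    rw [norm_gnsClass, norm_gnsClass, ← Real.sqrt_mul]
    exact (RCLike.nonneg_iff.mp (ω.map_nonneg (star_mul_self_nonneg a))).1
  · simp only [vacuumRep_gnsClass, inner_gnsClass]
    rw [Semi.dilation, ← hF]
    congr 1
    funext i
    simp [max_eq_left ht]

lemma hasQuadrantExtension_vacuumRep (hω : IsVacuumState N ω) {e : Spacetime}
    (he : e ∈ forwardCone) (φ ψ : ω.GNS) : HasQuadrantExtension
      (fun t => ⟪φ, vacuumRep hω (Semi.dilation he t) ψ⟫_ℂ) (‖φ‖ * ‖ψ‖) := by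
  refine hasQuadrantExtension_inner_of_dense (fun t ψ => norm_vacuumRep_apply hω _ ψ)
    (D := gnsRange ω) (denseRange_gnsClass ω) ?_ φ ψ
  rintro _ ⟨a, rfl⟩ _ ⟨b, rfl⟩
  exact hasQuadrantExtension_gnsClass hω he a b

/-- The unitary representation of the semigroup on the GNS space of a vacuum state. -/
noncomputable def vacuumUnitaryRep (hω : IsVacuumState N ω) :
    Semi →* unitary (ω.GNS →L[ℂ] ω.GNS) :=
  (vacuumRep hω).codRestrict _ (mem_unitary_of_hasQuadrantExtension _
    (star_vacuumRep_mul_self hω) fun _ he => hasQuadrantExtension_vacuumRep hω he)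

lemma vacuumRep_mul_star_self (hω : IsVacuumState N ω) (g : Semi) :
    vacuumRep hω g * star (vacuumRep hω g) = 1 :=
  Unitary.mul_star_self_of_mem (vacuumUnitaryRep hω g).2

lemma vacuumRep_mul_gnsStarAlgHom (hω : IsVacuumState N ω) (g : Semi) (a : A) :
    vacuumRep hω g * ω.gnsStarAlgHom a = ω.gnsStarAlgHom (N.endo g a) * vacuumRep hω g :=
  eq_of_eq_on_gnsClass fun b => by
    rw [mul_apply_eq_comp, mul_apply_eq_comp, gnsStarAlgHom_gnsClass, vacuumRep_gnsClass,
      vacuumRep_gnsClass, gnsStarAlgHom_gnsClass, map_mul]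

lemma isCyclic_gnsVector (hω : IsVacuumState N ω) (g : Semi) :
    IsCyclic ((N.endo g).range.map ω.gnsStarAlgHom) (gnsVector ω) := by
  have hsurj : Function.Surjective (vacuumRep hω g) := fun y =>
    ⟨star (vacuumRep hω g) y, by
      rw [← mul_apply_eq_comp, vacuumRep_mul_star_self]; rfl⟩
  have h := hsurj.denseRange.comp (denseRange_gnsClass ω) (vacuumRep hω g).continuous
  refine h.mono ?_
  rintro _ ⟨a, rfl⟩
  refine ⟨ω.gnsStarAlgHom (N.endo g a), ⟨N.endo g a, ⟨a, rfl⟩, rfl⟩, ?_⟩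
  rw [gnsStarAlgHom_gnsVector, Function.comp_apply, vacuumRep_gnsClass]

lemma vacuumRep_gnsVector (hω : IsVacuumState N ω) (g : Semi) :
    vacuumRep hω g (gnsVector ω) = gnsVector ω :=
  (vacuumRep_gnsClass hω g 1).trans (by rw [map_one]; rfl)

end GNS

end LightCone

theorem mainTheorem5 {A : Type*} [CStarAlgebra A] [PartialOrder A] [StarOrderedRing A]
    (N : LightCone.LocalNet A) (ω : A →ₚ[ℂ] ℂ) (hω : LightCone.IsVacuumState N ω) :
    (∀ g : LightCone.Semi,
      LightCone.IsCyclic ((N.endo g).range.map ω.gnsStarAlgHom) (LightCone.gnsVector ω)) ∧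
    ∃ U : LightCone.Poincare →* unitary (ω.GNS →L[ℂ] ω.GNS),
      (∀ ψ : ω.GNS, Continuous fun g : LightCone.Poincare => (U g : ω.GNS →L[ℂ] ω.GNS) ψ) ∧
      (∀ g : LightCone.Poincare,
        (U g : ω.GNS →L[ℂ] ω.GNS) (LightCone.gnsVector ω) = LightCone.gnsVector ω) ∧
      (∀ (g : LightCone.Semi) (a : A),
        (U g : ω.GNS →L[ℂ] ω.GNS) * ω.gnsStarAlgHom a * star (U g : ω.GNS →L[ℂ] ω.GNS) =
          ω.gnsStarAlgHom (N.endo g a)) ∧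
      LightCone.translationSpectrum
          (fun x => (U (LightCone.Poincare.translation x) : ω.GNS →L[ℂ] ω.GNS)) ⊆
        LightCone.closedForwardCone := by
  obtain ⟨U, hU, hc⟩ := LightCone.exists_unitary_extension (LightCone.vacuumUnitaryRep hω)
    (LightCone.continuous_vacuumRep_apply hω)
  have hUV : ∀ g : LightCone.Semi, (U g : ω.GNS →L[ℂ] ω.GNS) = LightCone.vacuumRep hω g :=
    fun g => by rw [hU]; rfl
  refine ⟨LightCone.isCyclic_gnsVector hω, U, hc, fun g => ?_, fun g a => ?_,
    LightCone.translationSpectrum_subset U hc fun e he φ ψ => ?_⟩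
  -- Both s and s * g fix the vacuum vector, and U(s) is injective.
  · obtain ⟨s, hs, hsg⟩ := LightCone.exists_translation_mul_mem g
    have h1 : (U s : ω.GNS →L[ℂ] ω.GNS) (LightCone.gnsVector ω) = LightCone.gnsVector ω := by
      rw [hUV ⟨s, hs⟩, LightCone.vacuumRep_gnsVector]
    have h2 : (U s : ω.GNS →L[ℂ] ω.GNS) ((U g : ω.GNS →L[ℂ] ω.GNS) (LightCone.gnsVector ω)) =
        LightCone.gnsVector ω := by
      rw [← mul_apply_eq_comp, ← Submonoid.coe_mul, ← map_mul, hUV ⟨s * g, hsg⟩,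
        LightCone.vacuumRep_gnsVector]
    exact (Unitary.linearIsometryEquiv (U s)).injective (h2.trans h1.symm)
  · rw [hUV, LightCone.vacuumRep_mul_gnsStarAlgHom, mul_assoc,
      LightCone.vacuumRep_mul_star_self, mul_one]
  · obtain ⟨f, hf, hd, hb, hft⟩ := LightCone.hasQuadrantExtension_vacuumRep hω he φ ψ
    refine ⟨f, hf, hd, hb, fun t ht => ?_⟩
    rw [hft t ht]
    simp only
    rw [← hUV]
    simp [LightCone.Semi.dilation, LightCone.Semi.translation, max_eq_left ht]
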